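/- **Conventions.** $\mathbb H_{\mathbb R}$ and $\mathbb H_{\mathbb C}$ denote the real and the complex quaternions $p=p_0+p_1e_1+p_2e_2+p_3e_3$ (with $p_i$ in $\mathbb R$, respectively $\mathbb C$), $|p|^2=\sum_i|p_i|^2$. For $q=a+v\in\mathbb H_{\mathbb R}$ with scalar part $\mathrm{Sc}\,q=a$ and vector part $v$, and $z\in\mathbb C\setminus\{0\}$, put $$z^q=z^a\Big[\cos(|v|\log z)+\tfrac{v}{|v|}\sin(|v|\log z)\Big]\in\mathbb H_{\mathbb C}$$ (principal branch; the second term is $0$ if $v=0$), and $0^q=0$ for $a>0$. Let $\Xi(\xi)=\frac{1-e^{-i\xi}}{i\xi}$, $\Xi(0)=1$. For $\mathrm{Sc}\,q>1$ the quaternionic B-spline is $$B_q(t)=\frac1{2\pi}\int_{\mathbb R}\widehat{B_q}(\xi)e^{i\xi t}\,d\xi,\qquad \widehat{B_q}(\xi)=\Xi(\xi)^q .$$ Let $R\subseteq\mathbb C$ be symmetric about the real axis and such that, for every $w\in R$ with $\mathrm{Re}\,w>1$ and every $\alpha\in(0,1)$, $$\zeta(w,\alpha)+e^{-i\pi w}\zeta(w,1-\alpha)\neq0,$$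 where $\zeta(\cdot,\cdot)$ is the Hurwitz zeta function, and let $Q_R=\{q=a+v\in\mathbb H_{\mathbb R}:a+i|v|\in R\}$. For $q\in Q_R$ with $\mathrm{Sc}\,q>1$ the fundamental cardinal spline is $$L_q(t)=\frac1{2\pi}\int_{\mathbb R}\widehat{L_q}(\xi)e^{i\xi t}\,d\xi,\qquad \widehat{L_q}(\xi)=\widehat{B_q}(\xi)\Big(\sum_{k\in\mathbb Z}\widehat{B_q}(\xi+2\pi k)\Big)^{-1}.$$ For $\varphi:\mathbb R\to\mathbb H_{\mathbb C}$ write $$\mathrm{clos}_{\ell^2}\mathrm{span}\{\varphi(\cdot-k)\}=\Big\{f=\sum_{k\in\mathbb Z}a_k\varphi(\cdot-k)\ \text{(pointwise)}:\ a_k\in\mathbb H_{\mathbb C},\ \sum_k|a_k|^2<\infty\Big\}.$$ **Theorem (sampling theorem for the quaternionic spline space).** Let $q\in Q_R$ with $\mathrm{Sc}\,q>1$ and let $\mathcal H=\mathrm{clos}_{\ell^2}\mathrm{span}\{B_q(\cdot-k)\}$. Then: 1. Every $f\in\mathcal H$ belongs to $L^2(\mathbb R,\mathbb H_{\mathbb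 C})$ and satisfies $$f(t)=\lim_{N\to\infty}\sum_{k=-N}^{N}f(k)\,L_q(t-k),$$ where the partial sums lie in $L^2(\mathbb R,\mathbb H_{\mathbb C})$ and the convergence holds in the $L^2(\mathbb R)$ norm, pointwise for every $t\in\mathbb R$, and uniformly on compact sets. 2. $\mathcal H=\mathrm{clos}_{\ell^2}\mathrm{span}\{L_q(\cdot-k)\}$. 3. For $\varphi=B_q$ and for $\varphi=L_q$: for every $(a_k)\in\ell^2(\mathbb Z,\mathbb H_{\mathbb C})$ the series $\sum_ka_k\varphi(t-k)$ converges for every $t\in\mathbb R$, and there are constants $c,C>0$ (depending only on $q$) such that $$c\Big(\sum_k|a_k|^2\Big)^{1/2}\le\Big\|\sum_ka_k\varphi(\cdot-k)\Big\|_{L^2(\mathbb R)}\le C\Big(\sum_k|a_k|^2\Big)^{1/2}$$ for all $(a_k)\in\ell^2(\mathbb Z,\mathbb H_{\mathbb C})$. -/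

import Mathlib

namespace QuatSpline

noncomputable section

/-- Coordinates of a complex quaternion, as a linear map into `ℂ⁴` with the Euclidean norm. -/
def toEuclidean : Quaternion ℂ →ₗ[ℂ] EuclideanSpace ℂ (Fin 4) where
  toFun p := WithLp.toLp 2 ![p.re, p.imI, p.imJ, p.imK]
  map_add' p r := by ext i; fin_cases i <;> simp
  map_smul' c p := by ext i; fin_cases i <;> simp

theorem toEuclidean_injective : Function.Injective toEuclidean := by
  intro p r h
  have h' := fun i => congrArg (fun x : EuclideanSpace ℂ (Fin 4) => x i) h
  apply Quaternion.ext
  · simpa [toEuclidean] using h' 0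
  · simpa [toEuclidean] using h' 1
  · simpa [toEuclidean] using h' 2
  · simpa [toEuclidean] using h' 3

/-- The algebra of complex quaternions carries the norm `|p|² = ∑ |pᵢ|²`. -/
instance instNormedAddCommGroup : NormedAddCommGroup (Quaternion ℂ) :=
  NormedAddCommGroup.induced (Quaternion ℂ) (EuclideanSpace ℂ (Fin 4)) toEuclidean
    toEuclidean_injective

theorem norm_def (p : Quaternion ℂ) : ‖p‖ = ‖toEuclidean p‖ := rfl

theorem norm_sq_eq (p : Quaternion ℂ) :
    ‖p‖ ^ 2 = ‖p.re‖ ^ 2 + ‖p.imI‖ ^ 2 + ‖p.imJ‖ ^ 2 + ‖p.imK‖ ^ 2 := by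
  rw [norm_def, EuclideanSpace.norm_sq_eq]
  simp [toEuclidean, Fin.sum_univ_four]

instance instNormedSpace : NormedSpace ℂ (Quaternion ℂ) where
  norm_smul_le c p := by
    rw [norm_def, norm_def, map_smul, norm_smul]

/-- For a real quaternion `q = a + v`, the element `v / |v|` of the complex quaternions
(it is `0` if `v = 0`). -/
def unitVec (q : Quaternion ℝ) : Quaternion ℂ :=
  ⟨0, ((q.imI / ‖q.im‖ : ℝ) : ℂ), ((q.imJ / ‖q.im‖ : ℝ) : ℂ), ((q.imK / ‖q.im‖ : ℝ) : ℂ)⟩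

/-- The quaternionic power
`z ^ q = z ^ a * (cos (|v| log z) + (v / |v|) * sin (|v| log z))`, where `q = a + v` and `log` is
the principal branch; for `a ≠ 0` the value at `z = 0` is `0`. -/
def qpow (z : ℂ) (q : Quaternion ℝ) : Quaternion ℂ :=
  z ^ (q.re : ℂ) •
    (Complex.cos (‖q.im‖ * Complex.log z) • (1 : Quaternion ℂ)
      + Complex.sin (‖q.im‖ * Complex.log z) • unitVec q)

/-- `Ξ(ξ) = (1 - e^{-iξ}) / (iξ)`, with the removable singularity at `0` filled in. -/
def Xi (ξ : ℝ) : ℂ :=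
  if ξ = 0 then 1 else (1 - Complex.exp (-(Complex.I * ξ))) / (Complex.I * ξ)

/-- The inverse of the Fourier transform `f̂(ξ) = ∫ f(x) e^{-iξx} dx`. -/
def invFourier (g : ℝ → Quaternion ℂ) (t : ℝ) : Quaternion ℂ :=
  (1 / (2 * Real.pi) : ℂ) • ∫ ξ : ℝ, Complex.exp (Complex.I * ξ * t) • g ξ

/-- The Fourier transform `Ξ(ξ) ^ q` of the quaternionic B-spline of order `q`. -/
def bsplineHat (q : Quaternion ℝ) (ξ : ℝ) : Quaternion ℂ := qpow (Xi ξ) q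

/-- The quaternionic B-spline `B_q` (used for `Sc q > 1`, when its transform is integrable). -/
def bspline (q : Quaternion ℝ) : ℝ → Quaternion ℂ := invFourier (bsplineHat q)

/-- The Fourier transform `B̂_q(ξ) (∑ₖ B̂_q(ξ + 2πk))⁻¹` of the fundamental cardinal spline. -/
def cardinalHat (q : Quaternion ℝ) (ξ : ℝ) : Quaternion ℂ :=
  bsplineHat q ξ * Ring.inverse (∑' k : ℤ, bsplineHat q (ξ + 2 * Real.pi * k))

/-- The fundamental cardinal spline `L_q` of quaternionic order `q`. -/
def cardinalSpline (q : Quaternion ℝ) : ℝ → Quaternion ℂ := invFourier (cardinalHat q)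

/-- A set `R ⊆ ℂ`, symmetric about the real axis, on which (as far as `Re w > 1`) the combination
`ζ(w, α) + e^{-iπw} ζ(w, 1 - α)` of Hurwitz zeta functions has no zero for any `α ∈ (0, 1)`. -/
structure IsZeroFreeRegion (R : Set ℂ) : Prop where
  conj_mem : ∀ w ∈ R, (starRingEnd ℂ) w ∈ R
  zero_free : ∀ w ∈ R, 1 < w.re → ∀ α ∈ Set.Ioo (0 : ℝ) 1,
    HurwitzZeta.hurwitzZeta (α : UnitAddCircle) w
      + Complex.exp (-(Complex.I * Real.pi * w))
        * HurwitzZeta.hurwitzZeta ((1 - α : ℝ) : UnitAddCircle) w ≠ 0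

/-- `Q_R = {q = a + v : a + i|v| ∈ R}`. -/
def quatRegion (R : Set ℂ) : Set (Quaternion ℝ) :=
  {q | (q.re : ℂ) + Complex.I * (‖q.im‖ : ℂ) ∈ R}

/-- `f = ∑ₖ aₖ φ(· - k)` pointwise, with a square-summable sequence of left coefficients
`aₖ` in the complex quaternions. -/
def HasShiftExpansion (φ : ℝ → Quaternion ℂ) (a : ℤ → Quaternion ℂ) (f : ℝ → Quaternion ℂ) :
    Prop :=
  Summable (fun k => ‖a k‖ ^ 2) ∧ ∀ t : ℝ, HasSum (fun k : ℤ => a k * φ (t - k)) (f t)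

/-- The `ℓ²`-closed (left) span of the integer shifts of `φ`. -/
def shiftSpace (φ : ℝ → Quaternion ℂ) : Set (ℝ → Quaternion ℂ) :=
  {f | ∃ a : ℤ → Quaternion ℂ, HasShiftExpansion φ a f}

/-- The `ℓ²`-norm of a sequence of complex quaternions. -/
def l2norm (a : ℤ → Quaternion ℂ) : ℝ := Real.sqrt (∑' k : ℤ, ‖a k‖ ^ 2)

/-- Every square-summable sequence is the coefficient sequence of some `f` in the `ℓ²`-closed span
of the shifts of `φ`, and the `L²(ℝ)`-norm of `f` is equivalent to the `ℓ²`-norm of its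
coefficients. -/
def L2NormEquivalence (φ : ℝ → Quaternion ℂ) : Prop :=
  (∀ a : ℤ → Quaternion ℂ, Summable (fun k => ‖a k‖ ^ 2) → ∃ f, HasShiftExpansion φ a f) ∧
  ∃ c C : ℝ, 0 < c ∧ 0 < C ∧ ∀ a f, HasShiftExpansion φ a f →
    ENNReal.ofReal (c * l2norm a) ≤ MeasureTheory.eLpNorm f 2 MeasureTheory.volume ∧
    MeasureTheory.eLpNorm f 2 MeasureTheory.volume ≤ ENNReal.ofReal (C * l2norm a)

/-- The symmetric partial sum `∑_{k=-N}^{N} f(k) L_q(t - k)` of the sampling series. -/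
def samplingSum (q : Quaternion ℝ) (f : ℝ → Quaternion ℂ) (N : ℕ) (t : ℝ) : Quaternion ℂ :=
  ∑ k ∈ Finset.Icc (-(N : ℤ)) (N : ℤ), f k * cardinalSpline q (t - k)

end

end QuatSpline

namespace QuatSpline

open MeasureTheory TopologicalSpace AddCircle Filter Topology
open scoped FourierTransform ComplexConjugate ENNReal

noncomputable section

/-! Let n = v/|v| (any imaginary unit if v = 0) and w = a + i|v|. Since n² = -1, the elements e± =
(1 ∓ in)/2 are complementary orthogonal idempotents of the complex quaternions, and z^q = z^w e₊ +
z^{w̄} e₋ (`qpow_eq`). The coefficients stand on the left, so right multiplication by e± splits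
every shift expansion into two expansions with scalar generators (`IsIdempotentPair.hasSum_left`),
namely complex B-splines of orders w and w̄. Both orders lie in R because R is symmetric.

For a scalar transform g, in the variable x = ξ/2π, everything passes through the Zak transform. By
Poisson summation its Fourier coefficients are the shifts of the inverse transform of g
(`fourierCoeff_zak`). Parseval on the circle then gives ‖f‖² = ∫ |U(x)|² ∑ₙ |g(x+n)|² dx, with U the
symbol of the coefficients. The norm equivalence thus reduces to two-sided bounds on ∑ₙ |g(x+n)|²
(`HasRieszBounds.scalar_bounds`): decay of g gives the upper one, absence of zeros on [-1/2, 1/2]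
the lower one.

The periodization of Ξ(2πx)^w is a nonvanishing factor times a combination of Hurwitz zeta values,
so the hypothesis on R makes it zero-free (`IsZeroFreeRegion.zak_ne_zero`). Dividing by it is
multiplication by a continuous periodic function with continuous inverse, which acts on symbols and
leaves the shift space unchanged (`exists_change_of_generator`). The quotient has periodization 1,
so its inverse transform is 1 at 0 and 0 at the other integers (`synth_int`). Hence the coefficients
in the L_q-expansion are the samples f(k), and convergence of the sampling series is control of an
ℓ² tail (`sampling_of_bounds`). -/

/-! ### Generators and the Zak transform -/

/-- The integer translates of `g` are summable, uniformly on compact sets. -/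
def IsGenerator (g : C(ℝ, ℂ)) : Prop :=
  ∀ K : Compacts ℝ, Summable fun n : ℤ => ‖(g.comp (ContinuousMap.addRight (n : ℝ))).restrict K‖

/-- The character `x ↦ e^{2πixt}` of the real line. -/
def character (t : ℝ) : C(ℝ, ℂ) where
  toFun x := Complex.exp (2 * Real.pi * Complex.I * x * t)
  continuous_toFun := by fun_prop

theorem norm_character (t x : ℝ) : ‖character t x‖ = 1 := by
  have : character t x = Complex.exp ((2 * Real.pi * x * t : ℝ) * Complex.I) := by
    simp only [character, ContinuousMap.coe_mk]
    congr 1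
    push_cast
    ring
  rw [this, Complex.norm_exp_ofReal_mul_I]

theorem character_add_int (t x : ℝ) (n : ℤ) :
    character t (x + n) = character t x * fourier n (t : UnitAddCircle) := by
  rw [fourier_coe_apply]
  simp only [character, ContinuousMap.coe_mk]
  rw [← Complex.exp_add]
  congr 1
  push_cast
  ring

theorem character_sub_int (t x : ℝ) (n : ℤ) :
    character (t - n) x = fourier (-n) (x : UnitAddCircle) * character t x := by
  rw [fourier_coe_apply]
  simp only [character, ContinuousMap.coe_mk]
  rw [← Complex.exp_add]
  congr 1
  push_cast
  ring

theorem IsGenerator.of_norm_le {g h : C(ℝ, ℂ)} (hg : IsGenerator g) (C : ℝ)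
    (hC : ∀ x, ‖h x‖ ≤ C * ‖g x‖) : IsGenerator h := by
  intro K
  refine Summable.of_nonneg_of_le (fun _ => norm_nonneg _) (fun n => ?_) ((hg K).mul_left |C|)
  rw [ContinuousMap.norm_le _ (by positivity)]
  intro x
  refine (hC _).trans (mul_le_mul (le_abs_self C) ?_ (norm_nonneg _) (abs_nonneg C))
  exact ContinuousMap.norm_coe_le_norm
    ((g.comp (ContinuousMap.addRight (n : ℝ))).restrict (K : Set ℝ)) x

theorem IsGenerator.mul_character {g : C(ℝ, ℂ)} (hg : IsGenerator g) (t : ℝ) :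
    IsGenerator (g * character t) :=
  hg.of_norm_le 1 fun x => by simp [norm_character]

theorem IsGenerator.summable_norm {g : C(ℝ, ℂ)} (hg : IsGenerator g) (x : ℝ) :
    Summable fun n : ℤ => ‖g (x + n)‖ := by
  refine Summable.of_nonneg_of_le (fun _ => norm_nonneg _) (fun n => ?_) (hg {x})
  exact ContinuousMap.norm_coe_le_norm
    ((g.comp (ContinuousMap.addRight (n : ℝ))).restrict (({x} : Compacts ℝ) : Set ℝ)) ⟨x, by simp⟩

theorem IsGenerator.exists_bound {g : C(ℝ, ℂ)} (hg : IsGenerator g) :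
    ∃ M : ℝ, 0 < M ∧ ∀ x : ℝ, ∑' n : ℤ, ‖g (x + n)‖ ≤ M := by
  let K : Compacts ℝ := ⟨Set.Icc 0 1, isCompact_Icc⟩
  -- The summand 1 only serves to make the bound strictly positive.
  refine ⟨1 + ∑' n : ℤ, ‖(g.comp (ContinuousMap.addRight (n : ℝ))).restrict K‖,
    by positivity, fun x => ?_⟩
  have key : ∑' n : ℤ, ‖g (x + n)‖ = ∑' n : ℤ, ‖g (Int.fract x + n)‖ := by
    rw [← (Equiv.addRight (⌊x⌋ : ℤ)).tsum_eq (fun n : ℤ => ‖g (Int.fract x + n)‖)]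
    congr 1
    ext n
    congr 2
    simp only [Equiv.coe_addRight, Int.cast_add]
    linarith [Int.fract_add_floor x]
  rw [key]
  have := (hg.summable_norm (Int.fract x)).tsum_le_tsum (fun n => ?_) (hg K)
  · linarith
  · exact ContinuousMap.norm_coe_le_norm
      ((g.comp (ContinuousMap.addRight (n : ℝ))).restrict (K : Set ℝ))
      ⟨Int.fract x, Int.fract_nonneg x, (Int.fract_lt_one x).le⟩

/-- The Zak transform of `g`: the `1`-periodic function
`x ↦ ∑ₙ g(x + n) e^{2πi(x + n)t}`. -/
def zak (g : C(ℝ, ℂ)) (t : ℝ) : C(UnitAddCircle, ℂ) :=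
  ⟨((g * character t).periodic_tsum_comp_add_zsmul 1).lift,
    continuous_coinduced_dom.mpr (map_continuous _)⟩

theorem zak_coe {g : C(ℝ, ℂ)} (hg : IsGenerator g) (t x : ℝ) :
    zak g t (x : UnitAddCircle) = ∑' n : ℤ, g (x + n) * character t (x + n) := by
  have h := ContinuousMap.summable_of_locally_summable_norm (hg.mul_character t)
  have := (ContinuousMap.hasSum_apply h.hasSum x).tsum_eq
  simp only [zak, ContinuousMap.coe_mk, Function.Periodic.lift_coe, zsmul_one]
  rw [← this]
  rfl

/-- The inverse Fourier transform `t ↦ ∫ g(x) e^{2πixt} dx`. -/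
def synth (g : C(ℝ, ℂ)) (t : ℝ) : ℂ := ∫ x : ℝ, g x * character t x

/-- Poisson summation: the k-th coefficient of the periodization of g(x)e^{2πixt} is the integral of
g(x)e^{2πix(t-k)}. One continuous function on the circle thus encodes all integer shifts. -/
theorem fourierCoeff_zak {g : C(ℝ, ℂ)} (hg : IsGenerator g) (t : ℝ) (k : ℤ) :
    fourierCoeff (zak g t) k = synth g (t - k) := by
  have := Real.fourierCoeff_tsum_comp_add (hg.mul_character t) k
  rw [zak, ContinuousMap.coe_mk, this, Real.fourier_real_eq_integral_exp_smul, synth]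
  congr 1
  ext x
  rw [character_sub_int, fourier_coe_apply]
  simp only [ContinuousMap.mul_apply, smul_eq_mul]
  rw [mul_left_comm, ← mul_assoc, ← mul_assoc]
  congr 3
  push_cast
  ring

/-- The factor e^{-2πik(x+n)} does not depend on n and leaves the sum. -/
theorem zak_sub_int {g : C(ℝ, ℂ)} (hg : IsGenerator g) (t : ℝ) (k : ℤ) (y : UnitAddCircle) :
    zak g (t - k) y = fourier (-k) y * zak g t y := by
  obtain ⟨x, rfl⟩ := QuotientAddGroup.mk_surjective y
  rw [zak_coe hg, zak_coe hg, ← tsum_mul_left]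
  congr 1
  ext n
  rw [character_sub_int]
  have : ((x + n : ℝ) : UnitAddCircle) = x := by
    rw [AddCircle.coe_add]
    have h2 : ((n : ℝ) : UnitAddCircle) = 0 := by
      rw [AddCircle.coe_eq_zero_iff]
      exact ⟨n, by simp⟩
    rw [h2, add_zero]
  rw [this]
  ring

theorem norm_zak_le {g : C(ℝ, ℂ)} (hg : IsGenerator g) {M : ℝ}
    (hM : ∀ x : ℝ, ∑' n : ℤ, ‖g (x + n)‖ ≤ M) (t : ℝ) (y : UnitAddCircle) :
    ‖zak g t y‖ ≤ M := by
  obtain ⟨x, rfl⟩ := QuotientAddGroup.mk_surjective y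
  rw [zak_coe hg]
  refine (tsum_of_norm_bounded (hg.summable_norm x).hasSum fun n => ?_).trans (hM x)
  rw [norm_mul, norm_character, mul_one]

theorem continuous_zak_left {g : C(ℝ, ℂ)} (hg : IsGenerator g) (y : UnitAddCircle) :
    Continuous fun t => zak g t y := by
  obtain ⟨x, rfl⟩ := QuotientAddGroup.mk_surjective y
  simp only [zak_coe hg]
  refine continuous_tsum (fun n => ?_) (hg.summable_norm x) fun n t => ?_
  · simp only [character, ContinuousMap.coe_mk]
    fun_prop
  · rw [norm_mul, norm_character, mul_one]

/-- A Carathéodory argument, continuity in t with measurability in y, which provides the joint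
measurability needed for Tonelli. -/
theorem measurable_zak_uncurry {g : C(ℝ, ℂ)} (hg : IsGenerator g) :
    Measurable (Function.uncurry fun (t : ℝ) (y : UnitAddCircle) => zak g t y) :=
  (stronglyMeasurable_uncurry_of_continuous_of_stronglyMeasurable
    (u := fun (t : ℝ) (y : UnitAddCircle) => zak g t y) (continuous_zak_left hg)
    fun t => (map_continuous (zak g t)).stronglyMeasurable).measurable

/-! ### Parseval's identity on the circle -/

theorem ofReal_norm_sq {E : Type*} [NormedAddCommGroup E] (x : E) :
    ENNReal.ofReal (‖x‖ ^ 2) = ‖x‖ₑ ^ 2 := by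
  rw [ENNReal.ofReal_pow (norm_nonneg _), ofReal_norm]

theorem tsum_enorm_sq_eq_ofReal {ι E : Type*} [NormedAddCommGroup E] {a : ι → E}
    (ha : Summable fun k => ‖a k‖ ^ 2) :
    ∑' k, ‖a k‖ₑ ^ 2 = ENNReal.ofReal (∑' k, ‖a k‖ ^ 2) := by
  rw [ENNReal.ofReal_tsum_of_nonneg (fun _ => sq_nonneg _) ha]
  simp only [ofReal_norm_sq]

/-- Parseval's identity on the unit circle. -/
theorem parseval_lintegral {V : UnitAddCircle → ℂ} (hV : MemLp V 2 haarAddCircle) :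
    Summable (fun k => ‖fourierCoeff V k‖ ^ 2) ∧
      ∑' k, ‖fourierCoeff V k‖ₑ ^ 2 = ∫⁻ y, ‖V y‖ₑ ^ 2 ∂haarAddCircle := by
  have hae := hV.coeFn_toLp
  have h := hasSum_sq_fourierCoeff hV.toLp
  rw [fourierCoeff_congr_ae hae] at h
  refine ⟨h.summable, ?_⟩
  rw [tsum_enorm_sq_eq_ofReal h.summable, h.tsum_eq,
    ofReal_integral_eq_lintegral_ofReal]
  · simp only [ofReal_norm_sq]
    exact lintegral_congr_ae (hae.mono fun y hy => by simp only [hy])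
  · exact (memLp_two_iff_integrable_sq_norm (Lp.aestronglyMeasurable _)).1 (Lp.memLp _)
  · exact Eventually.of_forall fun _ => sq_nonneg _

theorem exists_memLp_fourierCoeff {a : ℤ → ℂ} (ha : Summable fun k => ‖a k‖ ^ 2) :
    ∃ U : UnitAddCircle → ℂ, MemLp U 2 haarAddCircle ∧ fourierCoeff U = a := by
  have hmem : Memℓp a 2 := by
    rw [memℓp_gen_iff (by norm_num)]
    simpa using ha
  refine ⟨fourierBasis.repr.symm ⟨a, hmem⟩, Lp.memLp _, ?_⟩
  ext k
  rw [← fourierBasis_repr]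
  simp

theorem hasSum_fourierCoeff_mul {U V : UnitAddCircle → ℂ} (hU : MemLp U 2 haarAddCircle)
    (hV : MemLp V 2 haarAddCircle) :
    HasSum (fun k => conj (fourierCoeff U k) * fourierCoeff V k)
      (∫ y, conj (U y) * V y ∂haarAddCircle) := by
  have h := fourierBasis.hasSum_inner_mul_inner hU.toLp hV.toLp
  have h1 (k : ℤ) : inner ℂ hU.toLp (fourierBasis k) * inner ℂ (fourierBasis k) hV.toLp
      = conj (fourierCoeff U k) * fourierCoeff V k := by
    rw [← inner_conj_symm, ← HilbertBasis.repr_apply_apply, ← HilbertBasis.repr_apply_apply,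
      fourierBasis_repr, fourierBasis_repr, fourierCoeff_congr_ae hU.coeFn_toLp,
      fourierCoeff_congr_ae hV.coeFn_toLp]
  simp only [h1] at h
  have h2 : inner ℂ hU.toLp hV.toLp = ∫ y, conj (U y) * V y ∂haarAddCircle := by
    rw [L2.inner_def]
    refine integral_congr_ae ?_
    filter_upwards [hU.coeFn_toLp, hV.coeFn_toLp] with y h1 h2
    rw [h1, h2, RCLike.inner_apply']
  rwa [h2] at h

theorem ContinuousMap.memLp_haar (f : C(UnitAddCircle, ℂ)) : MemLp f 2 haarAddCircle :=
  MemLp.of_bound (map_continuous f).aestronglyMeasurable ‖f‖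
    (Eventually.of_forall fun y => f.norm_coe_le_norm y)

theorem memLp_conj_mul {U : UnitAddCircle → ℂ} (hU : MemLp U 2 haarAddCircle)
    (f : C(UnitAddCircle, ℂ)) : MemLp (fun y => conj (U y) * f y) 2 haarAddCircle := by
  have h1 : MemLp (fun y => conj (U y)) 2 haarAddCircle := hU.star
  refine MemLp.of_le_mul (c := ‖f‖) h1
    (h1.1.mul (map_continuous f).aestronglyMeasurable) (Eventually.of_forall fun y => ?_)
  rw [norm_mul, mul_comm]
  exact mul_le_mul_of_nonneg_right (f.norm_coe_le_norm y) (norm_nonneg _)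

/-! ### Energy of scalar shift expansions -/

/-- The function with coefficient symbol `U` in the shift space of `synth g`. -/
def zakSynth (g : C(ℝ, ℂ)) (U : UnitAddCircle → ℂ) (t : ℝ) : ℂ :=
  ∫ y, conj (U y) * zak g t y ∂haarAddCircle

theorem hasSum_zakSynth {g : C(ℝ, ℂ)} (hg : IsGenerator g) {U : UnitAddCircle → ℂ}
    (hU : MemLp U 2 haarAddCircle) (t : ℝ) :
    HasSum (fun k : ℤ => conj (fourierCoeff U k) * synth g (t - k)) (zakSynth g U t) := by
  have := hasSum_fourierCoeff_mul hU (ContinuousMap.memLp_haar (zak g t))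
  simpa only [fourierCoeff_zak hg, zakSynth] using this

/-- The values along t - ℤ are themselves Fourier coefficients, so Parseval applies a second time,
to the sum over k of their squares. -/
theorem zakSynth_sub_int {g : C(ℝ, ℂ)} (hg : IsGenerator g) (U : UnitAddCircle → ℂ) (t : ℝ)
    (k : ℤ) : zakSynth g U (t - k) = fourierCoeff (fun y => conj (U y) * zak g t y) k := by
  rw [zakSynth, fourierCoeff]
  congr 1
  ext y
  rw [zak_sub_int hg, smul_eq_mul]
  ring

theorem lintegral_eq_tsum_sub_int (F : ℝ → ℝ≥0∞) :
    ∫⁻ t, F t = ∑' k : ℤ, ∫⁻ t in Set.Ioc (0 : ℝ) 1, F (t - k) := by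
  rw [← setLIntegral_univ, ← iUnion_Ioc_add_intCast (0 : ℝ),
    lintegral_iUnion (fun _ => measurableSet_Ioc) (Set.pairwise_disjoint_Ioc_add_intCast (0 : ℝ)),
    -- The line is cut into the intervals (k, k + 1], while the right-hand side shifts by -k; hence
    -- the sign change of the index.
    ← (Equiv.neg ℤ).tsum_eq]
  congr 1
  ext k
  have := (measurePreserving_sub_right volume (k : ℝ)).setLIntegral_comp_preimage_emb
    (measurableEmbedding_subRight (k : ℝ)) F (Set.Ioc (0 + ((-k : ℤ) : ℝ)) (0 + ((-k : ℤ) : ℝ) + 1))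
  rw [Equiv.neg_apply, ← this]
  congr 2
  ext x
  simp only [Set.mem_preimage, Set.mem_Ioc, Int.cast_neg]
  constructor <;> rintro ⟨h1, h2⟩ <;> constructor <;> linarith

/-- The line is folded onto (0, 1], Parseval turns the sum over shifts into an integral over the
circle, and Tonelli exchanges the two integrals. -/
theorem lintegral_zakSynth {g : C(ℝ, ℂ)} (hg : IsGenerator g) {U : UnitAddCircle → ℂ}
    (hU : MemLp U 2 haarAddCircle) (hm : Measurable (zakSynth g U)) :
    ∫⁻ t, ‖zakSynth g U t‖ₑ ^ 2 =
      ∫⁻ y, ‖U y‖ₑ ^ 2 * (∫⁻ t in Set.Ioc (0 : ℝ) 1, ‖zak g t y‖ₑ ^ 2) ∂haarAddCircle := by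
  rw [lintegral_eq_tsum_sub_int, ← lintegral_tsum]
  · have h1 (t : ℝ) : ∑' k : ℤ, ‖zakSynth g U (t - k)‖ₑ ^ 2
        = ∫⁻ y, ‖U y‖ₑ ^ 2 * ‖zak g t y‖ₑ ^ 2 ∂haarAddCircle := by
      simp only [zakSynth_sub_int hg]
      rw [(parseval_lintegral (memLp_conj_mul hU (zak g t))).2]
      congr 1
      ext y
      rw [enorm_mul, mul_pow, RCLike.enorm_conj]
    simp only [h1]
    rw [lintegral_lintegral_swap]
    · refine lintegral_congr fun y => ?_
      rw [lintegral_const_mul]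
      exact ((continuous_zak_left hg y).measurable.enorm.pow_const 2)
    · have h2 : AEMeasurable (fun p : ℝ × UnitAddCircle => ‖U p.2‖ₑ ^ 2)
          ((volume.restrict (Set.Ioc (0 : ℝ) 1)).prod haarAddCircle) :=
        (hU.1.enorm.pow_const 2).comp_snd
      exact h2.mul ((measurable_zak_uncurry hg).enorm.pow_const 2).aemeasurable
  · intro k
    exact ((hm.comp (measurable_id.sub_const (k : ℝ))).enorm.pow_const 2).aemeasurable

/-- This identifies the weight in `lintegral_zakSynth`. For fixed x the Zak transform is, as a
function of t, a unimodular factor times the Fourier series with coefficients g(x+n); Parseval is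
now used in t. -/
theorem lintegral_zak {g : C(ℝ, ℂ)} (hg : IsGenerator g) (x : ℝ) :
    ∫⁻ t in Set.Ioc (0 : ℝ) 1, ‖zak g t (x : UnitAddCircle)‖ₑ ^ 2
      = ∑' n : ℤ, ‖g (x + n)‖ₑ ^ 2 := by
  have hs : Summable fun n : ℤ => g (x + n) • (fourier n : C(UnitAddCircle, ℂ)) := by
    refine Summable.of_norm ?_
    simpa [norm_smul, fourier_norm] using hg.summable_norm x
  set S : C(UnitAddCircle, ℂ) := ∑' n : ℤ, g (x + n) • (fourier n : C(UnitAddCircle, ℂ)) with hS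
  have hcoef (k : ℤ) : fourierCoeff S k = g (x + k) := by
    rw [← fourierCoeff_toLp, ← fourierBasis_repr]
    have h2 : HasSum (fun n : ℤ => g (x + n) • fourierLp (T := 1) 2 n)
        (ContinuousMap.toLp (E := ℂ) 2 haarAddCircle ℂ S) := by
      simpa using hs.hasSum.mapL (ContinuousMap.toLp (E := ℂ) 2 haarAddCircle ℂ)
    have h3 := h2.mapL (innerSL ℂ (fourierLp (T := 1) 2 k))
    rw [HilbertBasis.repr_apply_apply, coe_fourierBasis]
    have h4 (n : ℤ) : innerSL ℂ (fourierLp (T := 1) 2 k) (g (x + n) • fourierLp (T := 1) 2 n)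
        = if n = k then g (x + k) else 0 := by
      rw [innerSL_apply_apply, inner_smul_right, orthonormal_iff_ite.1 orthonormal_fourier k n]
      by_cases h : n = k
      · simp [h]
      · simp [h, Ne.symm h]
    simp only [h4] at h3
    exact h3.unique (hasSum_ite_eq k (g (x + k)))
  have hP := (parseval_lintegral (ContinuousMap.memLp_haar S)).2
  simp only [hcoef] at hP
  rw [hP]
  have hvol : (haarAddCircle : Measure UnitAddCircle) = volume := by
    rw [volume_eq_smul_haarAddCircle]; simp
  rw [hvol, ← UnitAddCircle.lintegral_preimage 0, zero_add]
  refine setLIntegral_congr_fun measurableSet_Ioc fun t _ => ?_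
  have h4 : zak g t (x : UnitAddCircle) = character t x * S (t : UnitAddCircle) := by
    rw [zak_coe hg, hS, ← (ContinuousMap.hasSum_apply hs.hasSum _).tsum_eq, ← tsum_mul_left]
    congr 1
    ext n
    rw [character_add_int]
    simp only [ContinuousMap.smul_apply, smul_eq_mul]
    ring
  simp only [h4]
  have h5 : ‖character t x‖ₑ = 1 := by
    rw [← ofReal_norm, norm_character, ENNReal.ofReal_one]
  rw [enorm_mul, h5, one_mul]

theorem IsGenerator.integrable {g : C(ℝ, ℂ)} (hg : IsGenerator g) : Integrable g :=
  Real.integrable_of_summable_norm_Icc (hg ⟨Set.Icc 0 1, isCompact_Icc⟩)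

theorem continuous_zakSynth {g : C(ℝ, ℂ)} (hg : IsGenerator g) {U : UnitAddCircle → ℂ}
    (hU : MemLp U 2 haarAddCircle) : Continuous (zakSynth g U) := by
  obtain ⟨M, hM0, hM⟩ := hg.exists_bound
  refine continuous_of_dominated (bound := fun y => ‖U y‖ * M) (fun t => ?_) (fun t => ?_)
    ((hU.integrable (by norm_num)).norm.mul_const M) (Eventually.of_forall fun y => ?_)
  · exact (memLp_conj_mul hU (zak g t)).1
  · refine Eventually.of_forall fun y => ?_
    rw [norm_mul, RCLike.norm_conj]
    exact mul_le_mul_of_nonneg_left (norm_zak_le hg hM t y) (norm_nonneg _)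
  · exact continuous_const.mul (continuous_zak_left hg y)

theorem exists_symbol {a : ℤ → ℂ} (ha : Summable fun k => ‖a k‖ ^ 2) :
    ∃ U : UnitAddCircle → ℂ, MemLp U 2 haarAddCircle ∧
      (∑' k, ‖a k‖ₑ ^ 2 = ∫⁻ y, ‖U y‖ₑ ^ 2 ∂haarAddCircle) ∧
      ∀ g : C(ℝ, ℂ), IsGenerator g → ∀ t : ℝ,
        HasSum (fun k : ℤ => synth g (t - k) * a k) (zakSynth g U t) := by
  -- The inner product is conjugate-linear in the symbol, so U carries the conjugate coefficients.
  obtain ⟨U, hU, hUa⟩ := exists_memLp_fourierCoeff (a := fun k => conj (a k))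
    (by simpa only [RCLike.norm_conj] using ha)
  refine ⟨U, hU, ?_, fun g hg t => ?_⟩
  · rw [← (parseval_lintegral hU).2, hUa]
    simp only [RCLike.enorm_conj]
  · simpa only [hUa, Complex.conj_conj, mul_comm] using hasSum_zakSynth hg hU t

/-- Upper and lower bounds for the energies of the integer translates of `g`. -/
structure HasRieszBounds (g : C(ℝ, ℂ)) (δ M : ℝ) : Prop where
  generator : IsGenerator g
  lower_pos : 0 < δ
  upper_pos : 0 < M
  lower : ∀ x : ℝ, ENNReal.ofReal δ ≤ ∑' n : ℤ, ‖g (x + n)‖ₑ ^ 2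
  upper : ∀ x : ℝ, ∑' n : ℤ, ‖g (x + n)‖ₑ ^ 2 ≤ ENNReal.ofReal M

/-- The energy of f is the integral of |U|² against the weight ∑ₙ |g(x+n)|², which lies between δ
and M. -/
theorem HasRieszBounds.scalar_bounds {g : C(ℝ, ℂ)} {δ M : ℝ} (hg : HasRieszBounds g δ M)
    {a : ℤ → ℂ} (ha : Summable fun k => ‖a k‖ ^ 2) {f : ℝ → ℂ}
    (hf : ∀ t : ℝ, HasSum (fun k : ℤ => synth g (t - k) * a k) (f t)) :
    Continuous f ∧ ENNReal.ofReal δ * ∑' k, ‖a k‖ₑ ^ 2 ≤ ∫⁻ t, ‖f t‖ₑ ^ 2 ∧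
      ∫⁻ t, ‖f t‖ₑ ^ 2 ≤ ENNReal.ofReal M * ∑' k, ‖a k‖ₑ ^ 2 := by
  obtain ⟨U, hU, hUa, hUs⟩ := exists_symbol ha
  obtain rfl : f = zakSynth g U := funext fun t => (hf t).unique (hUs g hg.generator t)
  have hc := continuous_zakSynth hg.generator hU
  have hUm : AEMeasurable (fun y => ‖U y‖ₑ ^ 2) haarAddCircle := hU.1.enorm.pow_const 2
  rw [lintegral_zakSynth hg.generator hU hc.measurable, hUa]
  refine ⟨hc, ?_, ?_⟩
  · rw [← lintegral_const_mul'' _ hUm]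
    refine lintegral_mono fun y => ?_
    obtain ⟨x, rfl⟩ := QuotientAddGroup.mk_surjective y
    rw [mul_comm]
    refine mul_le_mul_right ?_ _
    exact (hg.lower x).trans_eq (lintegral_zak hg.generator x).symm
  · rw [← lintegral_const_mul'' _ hUm]
    refine lintegral_mono fun y => ?_
    obtain ⟨x, rfl⟩ := QuotientAddGroup.mk_surjective y
    rw [mul_comm]
    refine mul_le_mul_left ?_ _
    exact (lintegral_zak hg.generator x).trans_le (hg.upper x)

theorem zak_eq_mul {g h : C(ℝ, ℂ)} (hg : IsGenerator g) (hh : IsGenerator h)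
    {G : C(UnitAddCircle, ℂ)} (hG : ∀ x : ℝ, g x = G (x : UnitAddCircle) * h x) (t : ℝ)
    (y : UnitAddCircle) : zak g t y = G y * zak h t y := by
  obtain ⟨x, rfl⟩ := QuotientAddGroup.mk_surjective y
  rw [zak_coe hg, zak_coe hh, ← tsum_mul_left]
  congr 1
  ext n
  have : ((x + n : ℝ) : UnitAddCircle) = x := by
    rw [AddCircle.coe_add]
    have h2 : ((n : ℝ) : UnitAddCircle) = 0 := by
      rw [AddCircle.coe_eq_zero_iff]
      exact ⟨n, by simp⟩
    rw [h2, add_zero]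
  rw [hG, this]
  exact mul_assoc _ _ _

/-- A periodic factor G leaves the Zak transform (`zak_eq_mul`) and can be moved to the symbol;
being bounded, it keeps the symbol in L². The same function is then expanded in the shifts of `synth
h`. -/
theorem exists_change_of_generator {g h : C(ℝ, ℂ)} (hg : IsGenerator g) (hh : IsGenerator h)
    {G : C(UnitAddCircle, ℂ)} (hG : ∀ x : ℝ, g x = G (x : UnitAddCircle) * h x)
    {a : ℤ → ℂ} (ha : Summable fun k => ‖a k‖ ^ 2) :
    ∃ b : ℤ → ℂ, Summable (fun k => ‖b k‖ ^ 2) ∧ ∀ (t : ℝ) (s : ℂ),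
      HasSum (fun k : ℤ => synth g (t - k) * a k) s →
        HasSum (fun k : ℤ => synth h (t - k) * b k) s := by
  obtain ⟨U, hU, -, hUs⟩ := exists_symbol ha
  have hV := (memLp_conj_mul hU G).star
  have hVc : ∀ y, conj ((star fun y => conj (U y) * G y) y) = conj (U y) * G y := fun y =>
    Complex.conj_conj _
  refine ⟨fun k => conj (fourierCoeff (star fun y => conj (U y) * G y) k), ?_, fun t s hs => ?_⟩
  · simpa only [RCLike.norm_conj] using (parseval_lintegral hV).1
  · have h1 := hasSum_zakSynth hh hV t
    have h2 : zakSynth h (star fun y => conj (U y) * G y) t = s := by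
      rw [← (hUs g hg t).unique hs, zakSynth, zakSynth]
      congr 1
      ext y
      rw [hVc, zak_eq_mul hg hh hG, mul_assoc]
    rw [h2] at h1
    simpa only [mul_comm] using h1

/-- Parseval for the Zak transform, which is bounded by M uniformly in t. With Cauchy–Schwarz this
gives convergence of every expansion and a bound uniform in t. -/
theorem synth_sq_bounds {g : C(ℝ, ℂ)} (hg : IsGenerator g) {M : ℝ}
    (hM : ∀ x : ℝ, ∑' n : ℤ, ‖g (x + n)‖ ≤ M) (t : ℝ) :
    Summable (fun k : ℤ => ‖synth g (t - k)‖ ^ 2) ∧ ∑' k : ℤ, ‖synth g (t - k)‖ ^ 2 ≤ M ^ 2 := by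
  have hM0 : 0 ≤ M := (tsum_nonneg fun _ => norm_nonneg _).trans (hM 0)
  have h := parseval_lintegral (ContinuousMap.memLp_haar (zak g t))
  simp only [fourierCoeff_zak hg] at h
  refine ⟨h.1, ?_⟩
  have h2 := h.2
  rw [tsum_enorm_sq_eq_ofReal h.1] at h2
  rw [← ENNReal.ofReal_le_ofReal_iff (by positivity), h2]
  calc ∫⁻ y, ‖zak g t y‖ₑ ^ 2 ∂haarAddCircle
      ≤ ∫⁻ _, ENNReal.ofReal (M ^ 2) ∂(haarAddCircle : Measure UnitAddCircle) := by
        refine lintegral_mono fun y => ?_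
        rw [← ofReal_norm_sq]
        exact ENNReal.ofReal_le_ofReal
          (pow_le_pow_left₀ (norm_nonneg _) (norm_zak_le hg hM t y) 2)
    _ = ENNReal.ofReal (M ^ 2) := by simp

/-- If the translates of `h` sum up to `1`, then `synth h` is a fundamental function of cardinal
interpolation. -/
theorem synth_int {h : C(ℝ, ℂ)} (hh : IsGenerator h) (h1 : ∀ x : ℝ, ∑' n : ℤ, h (x + n) = 1)
    (k : ℤ) : synth h k = if k = 0 then 1 else 0 := by
  have hz : (zak h 0 : UnitAddCircle → ℂ) = fourier 0 := by
    ext y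
    obtain ⟨x, rfl⟩ := QuotientAddGroup.mk_surjective y
    rw [zak_coe hh, fourier_zero, ← h1 x]
    simp [character]
  have := fourierCoeff_zak hh 0 (-k)
  rw [hz, fourierCoeff_fourier] at this
  simp only [Int.cast_neg, sub_neg_eq_add, zero_add] at this
  rw [← this]
  simp [Pi.single_apply]

/-! ### Coefficients in the complex quaternions -/

instance instIsScalarTowerQuaternion : IsScalarTower ℂ (Quaternion ℂ) (Quaternion ℂ) :=
  ⟨fun c x y => by ext <;> simp <;> ring⟩

instance instSMulCommClassQuaternion : SMulCommClass ℂ (Quaternion ℂ) (Quaternion ℂ) :=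
  ⟨fun c x y => by ext <;> simp <;> ring⟩

instance instCompleteSpaceQuaternion : CompleteSpace (Quaternion ℂ) :=
  FiniteDimensional.complete ℂ _

/-- The coordinates of a complex quaternion. -/
def coord (i : Fin 4) : Quaternion ℂ →L[ℂ] ℂ :=
  LinearMap.toContinuousLinearMap ((EuclideanSpace.proj i).toLinearMap ∘ₗ toEuclidean)

/-- Right multiplication by a fixed complex quaternion. -/
def mulRightL (e : Quaternion ℂ) : Quaternion ℂ →L[ℂ] Quaternion ℂ :=
  LinearMap.toContinuousLinearMap (LinearMap.mulRight ℂ e)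

@[simp]
theorem mulRightL_apply (e p : Quaternion ℂ) : mulRightL e p = p * e := rfl

theorem norm_sq_eq_sum_coord (p : Quaternion ℂ) : ‖p‖ ^ 2 = ∑ i, ‖coord i p‖ ^ 2 := by
  rw [norm_def, EuclideanSpace.norm_sq_eq]
  rfl

theorem enorm_sq_eq_sum_coord (p : Quaternion ℂ) : ‖p‖ₑ ^ 2 = ∑ i, ‖coord i p‖ₑ ^ 2 := by
  rw [← ofReal_norm_sq, norm_sq_eq_sum_coord, ENNReal.ofReal_sum_of_nonneg fun _ _ => sq_nonneg _]
  simp only [ofReal_norm_sq]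

theorem isometry_toEuclidean : Isometry toEuclidean :=
  AddMonoidHomClass.isometry_of_norm _ fun p => (norm_def p).symm

theorem continuous_of_coord {f : ℝ → Quaternion ℂ} (hf : ∀ i, Continuous fun t => coord i (f t)) :
    Continuous f := by
  rw [isometry_toEuclidean.isEmbedding.isInducing.continuous_iff]
  exact (PiLp.continuous_toLp 2 _).comp (continuous_pi hf)

theorem summable_coord_sq {a : ℤ → Quaternion ℂ} (ha : Summable fun k => ‖a k‖ ^ 2) (i : Fin 4) :
    Summable fun k => ‖coord i (a k)‖ ^ 2 := by
  refine Summable.of_nonneg_of_le (fun _ => sq_nonneg _) (fun k => ?_) ha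
  rw [norm_sq_eq_sum_coord]
  exact Finset.single_le_sum (f := fun i => ‖coord i (a k)‖ ^ 2) (fun _ _ => sq_nonneg _)
    (Finset.mem_univ i)

/-- Complex scalars act on each of the four coordinates separately and the norm is Euclidean, so the
scalar bounds add up without loss in the constants. -/
theorem HasRieszBounds.vector_bounds {g : C(ℝ, ℂ)} {δ M : ℝ} (hg : HasRieszBounds g δ M)
    {a : ℤ → Quaternion ℂ} (ha : Summable fun k => ‖a k‖ ^ 2) {f : ℝ → Quaternion ℂ}
    (hf : ∀ t : ℝ, HasSum (fun k : ℤ => synth g (t - k) • a k) (f t)) :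
    Continuous f ∧ ENNReal.ofReal δ * ∑' k, ‖a k‖ₑ ^ 2 ≤ ∫⁻ t, ‖f t‖ₑ ^ 2 ∧
      ∫⁻ t, ‖f t‖ₑ ^ 2 ≤ ENNReal.ofReal M * ∑' k, ‖a k‖ₑ ^ 2 := by
  have key (i : Fin 4) := hg.scalar_bounds (summable_coord_sq ha i) (f := fun t => coord i (f t))
    fun t => by simpa using (hf t).mapL (coord i)
  have hsum : ∑' k, ‖a k‖ₑ ^ 2 = ∑ i, ∑' k, ‖coord i (a k)‖ₑ ^ 2 := by
    simp only [enorm_sq_eq_sum_coord]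
    exact Summable.tsum_finsetSum fun _ _ => ENNReal.summable
  have hint : ∫⁻ t, ‖f t‖ₑ ^ 2 = ∑ i, ∫⁻ t, ‖coord i (f t)‖ₑ ^ 2 := by
    simp only [enorm_sq_eq_sum_coord]
    exact lintegral_finsetSum _ fun i _ => (key i).1.measurable.enorm.pow_const 2
  rw [hsum, hint, Finset.mul_sum, Finset.mul_sum]
  exact ⟨continuous_of_coord fun i => (key i).1, Finset.sum_le_sum fun i _ => (key i).2.1,
    Finset.sum_le_sum fun i _ => (key i).2.2⟩

/-- The complex quaternion with given coordinates. -/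
def ofCoord (c : Fin 4 → ℂ) : Quaternion ℂ := ⟨c 0, c 1, c 2, c 3⟩

theorem coord_ofCoord (c : Fin 4 → ℂ) (i : Fin 4) : coord i (ofCoord c) = c i := by
  fin_cases i <;> rfl

theorem hasSum_of_coord {b : ℤ → Quaternion ℂ} {s : Quaternion ℂ}
    (h : ∀ i, HasSum (fun k => coord i (b k)) (coord i s)) : HasSum b s := by
  rw [← isometry_toEuclidean.isEmbedding.isInducing.hasSum_iff]
  have h2 : HasSum (fun k j => coord j (b k)) fun j => coord j s := Pi.hasSum.2 h
  exact h2.mapL (PiLp.continuousLinearEquiv 2 ℂ fun _ : Fin 4 => ℂ).symm.toContinuousLinearMap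

theorem exists_vector_change_of_generator {g h : C(ℝ, ℂ)} (hg : IsGenerator g)
    (hh : IsGenerator h) {G : C(UnitAddCircle, ℂ)}
    (hG : ∀ x : ℝ, g x = G (x : UnitAddCircle) * h x)
    {a : ℤ → Quaternion ℂ} (ha : Summable fun k => ‖a k‖ ^ 2) :
    ∃ b : ℤ → Quaternion ℂ, Summable (fun k => ‖b k‖ ^ 2) ∧ ∀ (t : ℝ) (s : Quaternion ℂ),
      HasSum (fun k : ℤ => synth g (t - k) • a k) s →
        HasSum (fun k : ℤ => synth h (t - k) • b k) s := by
  choose b hb hbs using fun i => exists_change_of_generator hg hh hG (summable_coord_sq ha i)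
  refine ⟨fun k => ofCoord fun i => b i k, ?_, fun t s hs => hasSum_of_coord fun i => ?_⟩
  · simp only [norm_sq_eq_sum_coord, coord_ofCoord]
    exact summable_sum fun i _ => hb i
  · have h1 : HasSum (fun k : ℤ => synth g (t - k) * coord i (a k)) (coord i s) := by
      simpa using hs.mapL (coord i)
    simpa [coord_ofCoord] using hbs i t _ h1

theorem l2norm_nonneg (a : ℤ → Quaternion ℂ) : 0 ≤ l2norm a := Real.sqrt_nonneg _

theorem l2norm_sq (a : ℤ → Quaternion ℂ) : l2norm a ^ 2 = ∑' k, ‖a k‖ ^ 2 :=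
  Real.sq_sqrt (tsum_nonneg fun _ => sq_nonneg _)

theorem norm_tsum_smul_le {s : ℤ → ℂ} (hs : Summable fun k => ‖s k‖ ^ 2) {M : ℝ} (hM0 : 0 ≤ M)
    (hM : ∑' k, ‖s k‖ ^ 2 ≤ M ^ 2)
    {a : ℤ → Quaternion ℂ} (ha : Summable fun k => ‖a k‖ ^ 2) :
    Summable (fun k => s k • a k) ∧ ‖∑' k, s k • a k‖ ≤ M * l2norm a := by
  have h := Real.summable_and_inner_le_Lp_mul_Lq_tsum_of_nonneg Real.HolderConjugate.two_two
    (f := fun k => ‖s k‖) (g := fun k => ‖a k‖) (fun _ => norm_nonneg _) (fun _ => norm_nonneg _)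
    (by simpa using hs) (by simpa using ha)
  simp only [Real.rpow_ofNat, ← norm_smul, ← Real.sqrt_eq_rpow] at h
  refine ⟨h.1.of_norm, (norm_tsum_le_tsum_norm h.1).trans (h.2.trans ?_)⟩
  refine mul_le_mul_of_nonneg_right ?_ (Real.sqrt_nonneg _)
  rw [← Real.sqrt_sq hM0]
  exact Real.sqrt_le_sqrt hM

/-! ### Splitting along a pair of idempotents -/

/-- Two complementary orthogonal idempotents in the complex quaternions. -/
structure IsIdempotentPair (e₁ e₂ : Quaternion ℂ) : Prop where
  left_idem : e₁ * e₁ = e₁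
  right_idem : e₂ * e₂ = e₂
  left_right : e₁ * e₂ = 0
  right_left : e₂ * e₁ = 0
  add_eq_one : e₁ + e₂ = 1

/-- The function with components `synth g₁` and `synth g₂` along `e₁` and `e₂`. -/
def pairSynth (e₁ e₂ : Quaternion ℂ) (g₁ g₂ : C(ℝ, ℂ)) (t : ℝ) : Quaternion ℂ :=
  synth g₁ t • e₁ + synth g₂ t • e₂

theorem enorm_sq_mul_le (e x : Quaternion ℂ) :
    ‖x * e‖ₑ ^ 2 ≤ ENNReal.ofReal (‖mulRightL e‖ ^ 2) * ‖x‖ₑ ^ 2 := by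
  rw [← ofReal_norm_sq, ← ofReal_norm_sq, ← ENNReal.ofReal_mul (sq_nonneg _), ← mul_pow]
  exact ENNReal.ofReal_le_ofReal
    (pow_le_pow_left₀ (norm_nonneg _) ((mulRightL e).le_opNorm x) 2)

theorem enorm_add_sq_le (x y : Quaternion ℂ) : ‖x + y‖ₑ ^ 2 ≤ 2 * (‖x‖ₑ ^ 2 + ‖y‖ₑ ^ 2) := by
  have h : ‖x + y‖ ^ 2 ≤ 2 * (‖x‖ ^ 2 + ‖y‖ ^ 2) :=
    (pow_le_pow_left₀ (norm_nonneg _) (norm_add_le x y) 2).trans add_sq_le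
  have h2 := ENNReal.ofReal_le_ofReal h
  rw [ENNReal.ofReal_mul (by norm_num), ENNReal.ofReal_add (sq_nonneg _) (sq_nonneg _)] at h2
  simpa only [ofReal_norm_sq, ENNReal.ofReal_ofNat] using h2

theorem summable_mul_sq {a : ℤ → Quaternion ℂ} (ha : Summable fun k => ‖a k‖ ^ 2)
    (e : Quaternion ℂ) : Summable fun k => ‖a k * e‖ ^ 2 := by
  refine Summable.of_nonneg_of_le (fun _ => sq_nonneg _) (fun k => ?_)
    (ha.mul_left (‖mulRightL e‖ ^ 2))
  rw [← mul_pow]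
  exact pow_le_pow_left₀ (norm_nonneg _) ((mulRightL e).le_opNorm (a k)) 2

theorem summable_add_sq {a b : ℤ → Quaternion ℂ} (ha : Summable fun k => ‖a k‖ ^ 2)
    (hb : Summable fun k => ‖b k‖ ^ 2) : Summable fun k => ‖a k + b k‖ ^ 2 := by
  refine Summable.of_nonneg_of_le (fun _ => sq_nonneg _) (fun k => ?_) ((ha.add hb).mul_left 2)
  exact (pow_le_pow_left₀ (norm_nonneg _) (norm_add_le _ _) 2).trans add_sq_le

section

variable {e₁ e₂ : Quaternion ℂ} {g₁ g₂ h₁ h₂ : C(ℝ, ℂ)}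

theorem mul_pairSynth (p : Quaternion ℂ) (t : ℝ) :
    p * pairSynth e₁ e₂ g₁ g₂ t = synth g₁ t • (p * e₁) + synth g₂ t • (p * e₂) := by
  rw [pairSynth, mul_add, mul_smul_comm, mul_smul_comm]

theorem IsIdempotentPair.symm (he : IsIdempotentPair e₁ e₂) : IsIdempotentPair e₂ e₁ :=
  ⟨he.right_idem, he.left_idem, he.right_left, he.left_right, by rw [add_comm, he.add_eq_one]⟩

theorem pairSynth_comm : pairSynth e₁ e₂ g₁ g₂ = pairSynth e₂ e₁ g₂ g₁ :=
  funext fun _ => add_comm _ _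

/-- Right multiplication by e₁ annihilates the e₂ part of the generator and fixes its e₁ part,
leaving a scalar generator with coefficients aₖe₁. -/
theorem IsIdempotentPair.hasSum_left (he : IsIdempotentPair e₁ e₂) {a : ℤ → Quaternion ℂ}
    {t : ℝ} {s : Quaternion ℂ}
    (h : HasSum (fun k : ℤ => a k * pairSynth e₁ e₂ g₁ g₂ (t - k)) s) :
    HasSum (fun k : ℤ => synth g₁ (t - k) • (a k * e₁)) (s * e₁) := by
  have := h.mapL (mulRightL e₁)
  simpa [mul_pairSynth, add_mul, smul_mul_assoc, mul_assoc, he.left_idem, he.right_left] using this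

theorem IsIdempotentPair.hasSum_right (he : IsIdempotentPair e₁ e₂) {a : ℤ → Quaternion ℂ}
    {t : ℝ} {s : Quaternion ℂ}
    (h : HasSum (fun k : ℤ => a k * pairSynth e₁ e₂ g₁ g₂ (t - k)) s) :
    HasSum (fun k : ℤ => synth g₂ (t - k) • (a k * e₂)) (s * e₂) := by
  rw [pairSynth_comm] at h
  exact he.symm.hasSum_left h

theorem IsIdempotentPair.eq_add (he : IsIdempotentPair e₁ e₂) (x : Quaternion ℂ) :
    x = x * e₁ + x * e₂ := by
  rw [← mul_add, he.add_eq_one, mul_one]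

/-- Existence of the expansions and their pointwise bound. -/
theorem exists_sup_bound (hg₁ : IsGenerator g₁)
    (hg₂ : IsGenerator g₂) :
    ∃ C : ℝ, 0 ≤ C ∧ ∀ a : ℤ → Quaternion ℂ, Summable (fun k => ‖a k‖ ^ 2) → ∀ t : ℝ,
      Summable (fun k : ℤ => a k * pairSynth e₁ e₂ g₁ g₂ (t - k)) ∧
      ‖∑' k : ℤ, a k * pairSynth e₁ e₂ g₁ g₂ (t - k)‖ ≤ C * l2norm a := by
  obtain ⟨M₁, h0₁, hM₁⟩ := hg₁.exists_bound
  obtain ⟨M₂, h0₂, hM₂⟩ := hg₂.exists_bound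
  have l2 (a : ℤ → Quaternion ℂ) (ha : Summable fun k => ‖a k‖ ^ 2) (e : Quaternion ℂ) :
      l2norm (fun k => a k * e) ≤ ‖mulRightL e‖ * l2norm a := by
    rw [← pow_le_pow_iff_left₀ (l2norm_nonneg _)
      (mul_nonneg (norm_nonneg _) (l2norm_nonneg _)) two_ne_zero, mul_pow, l2norm_sq, l2norm_sq,
      ← tsum_mul_left]
    refine (summable_mul_sq ha e).tsum_le_tsum (fun k => ?_) (ha.mul_left _)
    rw [← mul_pow]
    exact pow_le_pow_left₀ (norm_nonneg _) ((mulRightL e).le_opNorm (a k)) 2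
  refine ⟨M₁ * ‖mulRightL e₁‖ + M₂ * ‖mulRightL e₂‖, by positivity, fun a ha t => ?_⟩
  have b₁ := synth_sq_bounds hg₁ hM₁ t
  have b₂ := synth_sq_bounds hg₂ hM₂ t
  have n₁ := norm_tsum_smul_le b₁.1 h0₁.le b₁.2 (summable_mul_sq ha e₁)
  have n₂ := norm_tsum_smul_le b₂.1 h0₂.le b₂.2 (summable_mul_sq ha e₂)
  simp only [mul_pairSynth]
  refine ⟨n₁.1.add n₂.1, ?_⟩
  rw [n₁.1.tsum_add n₂.1]
  refine (norm_add_le _ _).trans ?_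
  rw [add_mul, mul_assoc, mul_assoc]
  exact add_le_add (n₁.2.trans (mul_le_mul_of_nonneg_left (l2 a ha e₁) h0₁.le))
    (n₂.2.trans (mul_le_mul_of_nonneg_left (l2 a ha e₂) h0₂.le))

theorem HasRieszBounds.exists_common {δ₁ M₁ δ₂ M₂ : ℝ} (hg₁ : HasRieszBounds g₁ δ₁ M₁)
    (hg₂ : HasRieszBounds g₂ δ₂ M₂) :
    HasRieszBounds g₁ (min δ₁ δ₂) (max M₁ M₂) ∧ HasRieszBounds g₂ (min δ₁ δ₂) (max M₁ M₂) :=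
  ⟨⟨hg₁.generator, lt_min hg₁.lower_pos hg₂.lower_pos, lt_max_of_lt_left hg₁.upper_pos,
    fun x => (ENNReal.ofReal_le_ofReal (min_le_left _ _)).trans (hg₁.lower x),
    fun x => (hg₁.upper x).trans (ENNReal.ofReal_le_ofReal (le_max_left _ _))⟩,
  ⟨hg₂.generator, lt_min hg₁.lower_pos hg₂.lower_pos, lt_max_of_lt_left hg₁.upper_pos,
    fun x => (ENNReal.ofReal_le_ofReal (min_le_right _ _)).trans (hg₂.lower x),
    fun x => (hg₂.upper x).trans (ENNReal.ofReal_le_ofReal (le_max_right _ _))⟩⟩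

/-- The decomposition x = xe₁ + xe₂ need not be orthogonal, but |x|² and |xe₁|² + |xe₂|² are
comparable; the bounds of the two components therefore combine at the price of constants. -/
theorem IsIdempotentPair.exists_energy_bounds (he : IsIdempotentPair e₁ e₂) {δ M : ℝ}
    (hg₁ : HasRieszBounds g₁ δ M) (hg₂ : HasRieszBounds g₂ δ M) :
    ∃ A B : ℝ, 0 < A ∧ 0 < B ∧ ∀ a f, HasShiftExpansion (pairSynth e₁ e₂ g₁ g₂) a f →
      Continuous f ∧ ENNReal.ofReal A * ∑' k, ‖a k‖ₑ ^ 2 ≤ ∫⁻ t, ‖f t‖ₑ ^ 2 ∧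
      ∫⁻ t, ‖f t‖ₑ ^ 2 ≤ ENNReal.ofReal B * ∑' k, ‖a k‖ₑ ^ 2 := by
  set κ : ℝ := ‖mulRightL e₁‖ ^ 2 + ‖mulRightL e₂‖ ^ 2 + 1 with hκ
  have hκ0 : 0 < κ := by positivity
  have hδ := hg₁.lower_pos
  have hM := hg₁.upper_pos
  have hsplit (x : Quaternion ℂ) :
      ‖x * e₁‖ₑ ^ 2 + ‖x * e₂‖ₑ ^ 2 ≤ ENNReal.ofReal κ * ‖x‖ₑ ^ 2 := by
    refine (add_le_add (enorm_sq_mul_le e₁ x) (enorm_sq_mul_le e₂ x)).trans ?_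
    rw [← add_mul, ← ENNReal.ofReal_add (sq_nonneg _) (sq_nonneg _)]
    exact mul_le_mul_left (ENNReal.ofReal_le_ofReal (by linarith)) _
  have hjoin (x : Quaternion ℂ) : ‖x‖ₑ ^ 2 ≤ 2 * (‖x * e₁‖ₑ ^ 2 + ‖x * e₂‖ₑ ^ 2) := by
    conv_lhs => rw [he.eq_add x]
    exact enorm_add_sq_le _ _
  -- Each bound uses `hjoin` (factor 2) and `hsplit` (factor κ) once: on coefficients and function
  -- for the lower bound, the other way round for the upper.
  refine ⟨δ / (2 * κ), 2 * M * κ, by positivity, by positivity, fun a f ⟨ha, hf⟩ => ?_⟩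
  obtain ⟨c₁, l₁, u₁⟩ := hg₁.vector_bounds (summable_mul_sq ha e₁) fun t => he.hasSum_left (hf t)
  obtain ⟨c₂, l₂, u₂⟩ := hg₂.vector_bounds (summable_mul_sq ha e₂) fun t => he.hasSum_right (hf t)
  have hc : Continuous f := by
    rw [show f = fun t => f t * e₁ + f t * e₂ from funext fun t => he.eq_add (f t)]
    exact c₁.add c₂
  have hmeas : Measurable fun t => ‖f t * e₁‖ₑ ^ 2 := c₁.enorm.measurable.pow_const 2
  refine ⟨hc, ?_, ?_⟩
  · have h1 : ENNReal.ofReal δ * ∑' k, ‖a k‖ₑ ^ 2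
        ≤ ENNReal.ofReal (2 * κ) * ∫⁻ t, ‖f t‖ₑ ^ 2 := by
      calc ENNReal.ofReal δ * ∑' k, ‖a k‖ₑ ^ 2
          ≤ ENNReal.ofReal δ * ∑' k, 2 * (‖a k * e₁‖ₑ ^ 2 + ‖a k * e₂‖ₑ ^ 2) := by
            gcongr with k
            exact hjoin (a k)
        _ = 2 * (ENNReal.ofReal δ * ∑' k, ‖a k * e₁‖ₑ ^ 2
              + ENNReal.ofReal δ * ∑' k, ‖a k * e₂‖ₑ ^ 2) := by
            rw [ENNReal.tsum_mul_left, ENNReal.tsum_add]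
            ring
        _ ≤ 2 * ((∫⁻ t, ‖f t * e₁‖ₑ ^ 2) + ∫⁻ t, ‖f t * e₂‖ₑ ^ 2) := by gcongr
        _ = 2 * ∫⁻ t, (‖f t * e₁‖ₑ ^ 2 + ‖f t * e₂‖ₑ ^ 2) := by
            rw [lintegral_add_left hmeas]
        _ ≤ 2 * ∫⁻ t, ENNReal.ofReal κ * ‖f t‖ₑ ^ 2 := by
            gcongr with t
            exact hsplit (f t)
        _ = ENNReal.ofReal (2 * κ) * ∫⁻ t, ‖f t‖ₑ ^ 2 := by
            rw [lintegral_const_mul' _ _ ENNReal.ofReal_ne_top, ENNReal.ofReal_mul (by norm_num),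
              ENNReal.ofReal_ofNat, mul_assoc]
    rw [ENNReal.ofReal_div_of_pos (by positivity), ENNReal.div_eq_inv_mul, mul_assoc]
    exact (ENNReal.inv_mul_le_iff (by simpa using by positivity) ENNReal.ofReal_ne_top).2 h1
  · calc ∫⁻ t, ‖f t‖ₑ ^ 2 ≤ ∫⁻ t, 2 * (‖f t * e₁‖ₑ ^ 2 + ‖f t * e₂‖ₑ ^ 2) :=
          lintegral_mono fun t => hjoin (f t)
      _ = 2 * ((∫⁻ t, ‖f t * e₁‖ₑ ^ 2) + ∫⁻ t, ‖f t * e₂‖ₑ ^ 2) := by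
          rw [lintegral_const_mul' _ _ (by norm_num), lintegral_add_left hmeas]
      _ ≤ 2 * (ENNReal.ofReal M * ∑' k, ‖a k * e₁‖ₑ ^ 2
            + ENNReal.ofReal M * ∑' k, ‖a k * e₂‖ₑ ^ 2) := by gcongr
      _ = 2 * ENNReal.ofReal M * ∑' k, (‖a k * e₁‖ₑ ^ 2 + ‖a k * e₂‖ₑ ^ 2) := by
          rw [ENNReal.tsum_add]
          ring
      _ ≤ 2 * ENNReal.ofReal M * ∑' k, ENNReal.ofReal κ * ‖a k‖ₑ ^ 2 := by
          gcongr with k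
          exact hsplit (a k)
      _ = ENNReal.ofReal (2 * M * κ) * ∑' k, ‖a k‖ₑ ^ 2 := by
          rw [ENNReal.tsum_mul_left, ENNReal.ofReal_mul (by positivity),
            ENNReal.ofReal_mul (by norm_num), ENNReal.ofReal_ofNat, mul_assoc, mul_assoc, mul_assoc]

theorem eLpNorm_two_sq (f : ℝ → Quaternion ℂ) :
    eLpNorm f 2 volume ^ 2 = ∫⁻ t, ‖f t‖ₑ ^ 2 := by
  have := eLpNorm_nnreal_pow_eq_lintegral (f := f) (μ := volume) (p := 2) two_ne_zero
  simpa using this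

theorem ofReal_sqrt_mul_l2norm_sq {A : ℝ} (hA : 0 ≤ A) {a : ℤ → Quaternion ℂ}
    (ha : Summable fun k => ‖a k‖ ^ 2) :
    ENNReal.ofReal (√A * l2norm a) ^ 2 = ENNReal.ofReal A * ∑' k, ‖a k‖ₑ ^ 2 := by
  rw [← ENNReal.ofReal_pow (mul_nonneg (Real.sqrt_nonneg _) (l2norm_nonneg _)), mul_pow,
    Real.sq_sqrt hA, l2norm_sq, ENNReal.ofReal_mul hA, tsum_enorm_sq_eq_ofReal ha]

theorem IsIdempotentPair.exists_norm_bounds (he : IsIdempotentPair e₁ e₂) {δ M : ℝ}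
    (hg₁ : HasRieszBounds g₁ δ M) (hg₂ : HasRieszBounds g₂ δ M) :
    ∃ c C : ℝ, 0 < c ∧ 0 < C ∧ ∀ a f, HasShiftExpansion (pairSynth e₁ e₂ g₁ g₂) a f →
      Continuous f ∧ ENNReal.ofReal (c * l2norm a) ≤ eLpNorm f 2 volume ∧
      eLpNorm f 2 volume ≤ ENNReal.ofReal (C * l2norm a) := by
  obtain ⟨A, B, hA, hB, h⟩ := he.exists_energy_bounds hg₁ hg₂
  refine ⟨√A, √B, Real.sqrt_pos.2 hA, Real.sqrt_pos.2 hB, fun a f haf => ?_⟩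
  obtain ⟨hc, hl, hu⟩ := h a f haf
  refine ⟨hc, ?_, ?_⟩
  · rwa [← ENNReal.pow_le_pow_left_iff two_ne_zero, ofReal_sqrt_mul_l2norm_sq hA.le haf.1,
      eLpNorm_two_sq]
  · rwa [← ENNReal.pow_le_pow_left_iff two_ne_zero, ofReal_sqrt_mul_l2norm_sq hB.le haf.1,
      eLpNorm_two_sq]

theorem IsIdempotentPair.l2NormEquivalence (he : IsIdempotentPair e₁ e₂) {δ M : ℝ}
    (hg₁ : HasRieszBounds g₁ δ M) (hg₂ : HasRieszBounds g₂ δ M) :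
    L2NormEquivalence (pairSynth e₁ e₂ g₁ g₂) := by
  obtain ⟨c, C, hc, hC, h⟩ := he.exists_norm_bounds hg₁ hg₂
  obtain ⟨D, -, hD⟩ := exists_sup_bound (e₁ := e₁) (e₂ := e₂) hg₁.generator hg₂.generator
  exact ⟨fun a ha => ⟨_, ha, fun t => (hD a ha t).1.hasSum⟩, c, C, hc, hC,
    fun a f haf => (h a f haf).2⟩

theorem IsIdempotentPair.shiftSpace_subset (he : IsIdempotentPair e₁ e₂) (hg₁ : IsGenerator g₁)
    (hg₂ : IsGenerator g₂) (hh₁ : IsGenerator h₁) (hh₂ : IsGenerator h₂)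
    {G₁ G₂ : C(UnitAddCircle, ℂ)} (hG₁ : ∀ x : ℝ, g₁ x = G₁ (x : UnitAddCircle) * h₁ x)
    (hG₂ : ∀ x : ℝ, g₂ x = G₂ (x : UnitAddCircle) * h₂ x) :
    shiftSpace (pairSynth e₁ e₂ g₁ g₂) ⊆ shiftSpace (pairSynth e₁ e₂ h₁ h₂) := by
  rintro f ⟨a, ha, hf⟩
  obtain ⟨b, hb, hbs⟩ := exists_vector_change_of_generator hg₁ hh₁ hG₁ (summable_mul_sq ha e₁)
  obtain ⟨d, hd, hds⟩ := exists_vector_change_of_generator hg₂ hh₂ hG₂ (summable_mul_sq ha e₂)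
  -- The new coefficients of the two components are recombined; orthogonality of the idempotents
  -- removes the cross terms.
  refine ⟨fun k => b k * e₁ + d k * e₂,
    summable_add_sq (summable_mul_sq hb e₁) (summable_mul_sq hd e₂), fun t => ?_⟩
  have t₁ := (hbs t _ (he.hasSum_left (hf t))).mapL (mulRightL e₁)
  have t₂ := (hds t _ (he.hasSum_right (hf t))).mapL (mulRightL e₂)
  simp only [map_smul, mulRightL_apply, mul_assoc, he.left_idem, he.right_idem] at t₁ t₂
  rw [he.eq_add (f t)]
  have hk (k : ℤ) : (b k * e₁ + d k * e₂) * pairSynth e₁ e₂ h₁ h₂ (t - k)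
      = synth h₁ (t - k) • (b k * e₁) + synth h₂ (t - k) • (d k * e₂) := by
    rw [mul_pairSynth]
    simp only [add_mul, mul_assoc, he.left_idem, he.right_idem, he.left_right, he.right_left,
      mul_zero, add_zero, zero_add]
  simp only [hk]
  simpa only [smul_mul_assoc, mul_assoc, he.left_idem, he.right_idem] using t₁.add t₂

end

/-! ### Riesz bounds and the abstract sampling theorem -/

/-- Every real number has an integer translate in [-1/2, 1/2], where |g| has a positive minimum by
compactness; that single term bounds the sum below. Above, each |g(x+n)| is at most M, so the sum of
squares is at most M². -/
theorem IsGenerator.exists_rieszBounds {g : C(ℝ, ℂ)} (hg : IsGenerator g)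
    (h0 : ∀ x ∈ Set.Icc (-(1 / 2) : ℝ) (1 / 2), g x ≠ 0) :
    ∃ δ M : ℝ, HasRieszBounds g δ M := by
  obtain ⟨M, hM0, hM⟩ := hg.exists_bound
  obtain ⟨x₀, hx₀, hmin⟩ := (isCompact_Icc (a := (-(1 / 2) : ℝ)) (b := 1 / 2)).exists_isMinOn
    ⟨0, by norm_num⟩ (map_continuous g).norm.continuousOn
  have hpos : 0 < ‖g x₀‖ := norm_pos_iff.2 (h0 x₀ hx₀)
  have hsq (x : ℝ) : Summable (fun n : ℤ => ‖g (x + n)‖ ^ 2) ∧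
      ∑' n : ℤ, ‖g (x + n)‖ ^ 2 ≤ M ^ 2 := by
    have hs := hg.summable_norm x
    have hle (n : ℤ) : ‖g (x + n)‖ ^ 2 ≤ M * ‖g (x + n)‖ := by
      rw [sq]
      exact mul_le_mul_of_nonneg_right
        ((hs.le_tsum n fun _ _ => norm_nonneg _).trans (hM x)) (norm_nonneg _)
    have hs2 := Summable.of_nonneg_of_le (fun _ => sq_nonneg _) hle (hs.mul_left M)
    refine ⟨hs2, (hs2.tsum_le_tsum hle (hs.mul_left M)).trans ?_⟩
    rw [tsum_mul_left, sq]
    exact mul_le_mul_of_nonneg_left (hM x) hM0.le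
  refine ⟨‖g x₀‖ ^ 2, M ^ 2, hg, by positivity, by positivity, fun x => ?_, fun x => ?_⟩
  · refine le_trans ?_ (ENNReal.le_tsum (-round x))
    rw [← ofReal_norm_sq]
    refine ENNReal.ofReal_le_ofReal (pow_le_pow_left₀ (norm_nonneg _) (hmin ?_) 2)
    have := abs_le.1 (abs_sub_round x)
    rw [Int.cast_neg, ← sub_eq_add_neg]
    exact this
  · rw [tsum_enorm_sq_eq_ofReal (hsq x).1]
    exact ENNReal.ofReal_le_ofReal (hsq x).2

theorem hasSum_ite_mem {ι E : Type*} [DecidableEq ι] [AddCommMonoid E] [TopologicalSpace E]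
    (s : Finset ι) (f : ι → E) : HasSum (fun k => if k ∈ s then f k else 0) (∑ k ∈ s, f k) := by
  have h : HasSum (fun k => if k ∈ s then f k else 0) (∑ k ∈ s, if k ∈ s then f k else 0) :=
    hasSum_sum_of_ne_finset_zero fun b hb => if_neg hb
  rwa [Finset.sum_congr rfl fun k hk => if_pos hk] at h

theorem tendsto_l2norm_tail {a : ℤ → Quaternion ℂ} (ha : Summable fun k => ‖a k‖ ^ 2) :
    Tendsto (fun N : ℕ => l2norm fun k => if k ∈ Finset.Icc (-(N : ℤ)) N then 0 else a k)
      atTop (𝓝 0) := by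
  have h1 (N : ℕ) : ∑' k, ‖if k ∈ Finset.Icc (-(N : ℤ)) N then 0 else a k‖ ^ 2
      = ∑' k, ‖a k‖ ^ 2 - ∑ k ∈ Finset.Icc (-(N : ℤ)) N, ‖a k‖ ^ 2 := by
    have h2 := hasSum_ite_mem (Finset.Icc (-(N : ℤ)) N) fun k => ‖a k‖ ^ 2
    rw [← (ha.hasSum.sub h2).tsum_eq]
    congr 1
    ext k
    split_ifs <;> simp
  have h3 : Tendsto (fun N : ℕ => ∑' k, ‖a k‖ ^ 2 - ∑ k ∈ Finset.Icc (-(N : ℤ)) N, ‖a k‖ ^ 2)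
      atTop (𝓝 0) := by
    have := (ha.hasSum.comp (Finset.tendsto_Icc_neg (R := ℤ))).const_sub (∑' k, ‖a k‖ ^ 2)
    simpa using this
  simp only [l2norm, h1]
  simpa using h3.sqrt

/-- The sampling theorem for a function `Φ` that interpolates the unit sequence and whose shift
expansions are controlled by the `ℓ²`-norm of the coefficients. -/
theorem sampling_of_bounds {Φ : ℝ → Quaternion ℂ}
    (hΦ : ∀ k : ℤ, Φ k = if k = 0 then 1 else 0) {C D : ℝ}
    (hC : ∀ a f, HasShiftExpansion Φ a f →
      Continuous f ∧ eLpNorm f 2 volume ≤ ENNReal.ofReal (C * l2norm a))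
    (hD : ∀ a f, HasShiftExpansion Φ a f → ∀ t, ‖f t‖ ≤ D * l2norm a)
    {f : ℝ → Quaternion ℂ} (hf : f ∈ shiftSpace Φ) {S : ℕ → ℝ → Quaternion ℂ}
    (hS : ∀ N t, S N t = ∑ k ∈ Finset.Icc (-(N : ℤ)) (N : ℤ), f k * Φ (t - k)) :
    MemLp f 2 volume ∧ (∀ N, MemLp (S N) 2 volume) ∧
      Tendsto (fun N => eLpNorm (fun t => f t - S N t) 2 volume) atTop (𝓝 0) ∧
      (∀ t, Tendsto (fun N => S N t) atTop (𝓝 (f t))) ∧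
      ∀ K : Set ℝ, IsCompact K → TendstoUniformlyOn S f atTop K := by
  have hmem (a g) (h : HasShiftExpansion Φ a g) : MemLp g 2 volume :=
    ⟨(hC a g h).1.aestronglyMeasurable, (hC a g h).2.trans_lt ENNReal.ofReal_lt_top⟩
  obtain ⟨a, ha⟩ := hf
  have hfa (j : ℤ) : f j = a j := by
    have h1 := ha.2 j
    have h2 (k : ℤ) : a k * Φ (j - k) = if k = j then a j else 0 := by
      rw [← Int.cast_sub, hΦ]
      by_cases h : k = j
      · simp [h]
      · simp [h, sub_eq_zero, Ne.symm h]
    simp only [h2] at h1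
    exact h1.unique (hasSum_ite_eq j (a j))
  -- The error is itself a shift expansion, whose coefficients are the tail of a. Both the L² bound
  -- and the uniform bound therefore apply to it.
  have htail (N : ℕ) : HasShiftExpansion Φ
      (fun k => if k ∈ Finset.Icc (-(N : ℤ)) N then 0 else a k) fun t => f t - S N t := by
    refine ⟨Summable.of_nonneg_of_le (fun _ => sq_nonneg _) (fun k => ?_) ha.1, fun t => ?_⟩
    · dsimp only
      split_ifs
      · simp
      · exact le_rfl
    · have h2 : HasSum (fun k => if k ∈ Finset.Icc (-(N : ℤ)) N then a k * Φ (t - k) else 0)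
          (S N t) := by
        rw [hS]
        simp only [hfa]
        exact hasSum_ite_mem _ _
      have h3 := (ha.2 t).sub h2
      have h4 (k : ℤ) : a k * Φ (t - k)
          - (if k ∈ Finset.Icc (-(N : ℤ)) N then a k * Φ (t - k) else 0)
          = (if k ∈ Finset.Icc (-(N : ℤ)) N then 0 else a k) * Φ (t - k) := by
        split_ifs <;> simp
      simpa only [h4] using h3
  have hlim := tendsto_l2norm_tail ha.1
  have hunif : TendstoUniformly S f atTop := by
    rw [Metric.tendstoUniformly_iff]
    intro ε hε
    have hl := hlim.const_mul D
    rw [mul_zero] at hl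
    filter_upwards [hl.eventually (gt_mem_nhds hε)] with N hN t
    rw [dist_eq_norm]
    exact (hD _ _ (htail N) t).trans_lt hN
  refine ⟨hmem a f ha, fun N => ?_, ?_, fun t => hunif.tendsto_at t,
    fun K _ => hunif.tendstoUniformlyOn⟩
  -- The partial sum is f minus the error, and both are in L².
  · have := (hmem a f ha).sub (hmem _ _ (htail N))
    convert this using 1
    ext1 t
    simp
  · refine tendsto_of_tendsto_of_tendsto_of_le_of_le tendsto_const_nhds ?_ (fun _ => zero_le)
      fun N => (hC _ _ (htail N)).2
    have := ENNReal.tendsto_ofReal (hlim.const_mul C)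
    simpa using this

/-! ### The function Ξ and B-splines of complex order -/

theorem Xi_eq_sinc (ξ : ℝ) :
    Xi ξ = (Real.sinc ξ : ℂ) - Complex.I * (Real.sin (ξ / 2) * Real.sinc (ξ / 2) : ℝ) := by
  by_cases h : ξ = 0
  · simp [Xi, h]
  have hξ : (ξ : ℂ) ≠ 0 := by exact_mod_cast h
  have h2 : ξ / 2 ≠ 0 := by positivity
  have hcos : Complex.cos ξ = 1 - 2 * Complex.sin (ξ / 2) ^ 2 := by
    have := Complex.cos_two_mul (ξ / 2 : ℂ)
    rw [Complex.cos_sq'] at this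
    rw [show (ξ : ℂ) = 2 * (ξ / 2) by ring, this]
    ring_nf
  rw [Xi, if_neg h, Real.sinc_of_ne_zero h, Real.sinc_of_ne_zero h2]
  rw [show -(Complex.I * ξ) = ((-ξ : ℝ) : ℂ) * Complex.I by push_cast; ring, Complex.exp_mul_I]
  push_cast
  rw [Complex.cos_neg, Complex.sin_neg, hcos]
  field_simp
  linear_combination 2 * Complex.sin (ξ / 2) ^ 2 * Complex.I_sq

theorem continuous_Xi : Continuous Xi := by
  have : Xi = fun ξ : ℝ =>
      (Real.sinc ξ : ℂ) - Complex.I * (Real.sin (ξ / 2) * Real.sinc (ξ / 2) : ℝ) :=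
    funext Xi_eq_sinc
  rw [this]
  have h := Real.continuous_sinc
  fun_prop

theorem Xi_re_im {ξ : ℝ} (h : ξ ≠ 0) :
    (Xi ξ).re = Real.sin ξ / ξ ∧ (Xi ξ).im = (Real.cos ξ - 1) / ξ := by
  have hcos : Real.cos ξ = 1 - 2 * Real.sin (ξ / 2) ^ 2 := by
    have := Real.cos_two_mul (ξ / 2)
    rw [Real.cos_sq'] at this
    rw [show ξ = 2 * (ξ / 2) by ring, this]
    ring_nf
  have h2 : ξ / 2 ≠ 0 := by positivity
  rw [Xi_eq_sinc, Real.sinc_of_ne_zero h, Real.sinc_of_ne_zero h2, hcos]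
  constructor
  · simp only [Complex.sub_re, Complex.ofReal_im, Complex.mul_re, Complex.I_re, Complex.I_im,
      Complex.ofReal_re]
    ring
  · simp only [Complex.sub_im, Complex.ofReal_im, Complex.mul_im, Complex.I_re, Complex.I_im,
      Complex.ofReal_re]
    field_simp
    ring

/-- Where Im Ξ vanishes off the origin, cos ξ = 1, hence sin ξ = 0 and Ξ = 0. So Ξ never meets the
open negative real axis, and its principal powers with exponent of positive real part are
continuous. -/
theorem Xi_mem_domain (ξ : ℝ) : 0 ≤ (Xi ξ).re ∨ (Xi ξ).im ≠ 0 := by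
  by_cases h : ξ = 0
  · left
    simp [Xi, h]
  · rw [(Xi_re_im h).1, (Xi_re_im h).2]
    by_cases hc : Real.cos ξ = 1
    · left
      rw [(Real.sin_eq_zero_iff_cos_eq).2 (Or.inl hc), zero_div]
    · right
      exact div_ne_zero (sub_ne_zero.2 hc) h

theorem Xi_ne_zero {ξ : ℝ} (h : |ξ| ≤ Real.pi) : Xi ξ ≠ 0 := by
  by_cases h0 : ξ = 0
  · simp [Xi, h0]
  intro hX
  have h1 := (Xi_re_im h0).2
  rw [hX, Complex.zero_im, eq_comm, div_eq_zero_iff, or_iff_left h0, sub_eq_zero] at h1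
  have := abs_le.1 h
  exact h0 ((Real.cos_eq_one_iff_of_lt_of_lt (by linarith [Real.pi_pos])
    (by linarith [Real.pi_pos])).1 h1)

theorem norm_Xi_le {ξ : ℝ} (h : ξ ≠ 0) : ‖Xi ξ‖ ≤ 2 / |ξ| := by
  rw [Xi, if_neg h, norm_div, norm_mul, Complex.norm_I, one_mul, Complex.norm_real,
    Real.norm_eq_abs]
  gcongr
  refine (norm_sub_le _ _).trans ?_
  rw [show -(Complex.I * ξ) = ((-ξ : ℝ) : ℂ) * Complex.I by push_cast; ring,
    Complex.norm_exp_ofReal_mul_I]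
  norm_num

/-- The transform `Ξ(2πx)^w` of the B-spline of complex order `w`, in the frequency variable
`x = ξ / 2π`. -/
def complexBsplineHat (w : ℂ) (hw : 0 < w.re) : C(ℝ, ℂ) where
  toFun x := Xi (2 * Real.pi * x) ^ w
  continuous_toFun := by
    rw [continuous_iff_continuousAt]
    intro x
    have h1 : Continuous fun x : ℝ => (Xi (2 * Real.pi * x), w) :=
      (continuous_Xi.comp (continuous_const.mul continuous_id)).prodMk continuous_const
    exact (Complex.continuousAt_cpow_of_re_pos (p := (Xi (2 * Real.pi * x), w))
      (Xi_mem_domain _) hw).comp (f := fun x : ℝ => (Xi (2 * Real.pi * x), w)) h1.continuousAt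

theorem complexBsplineHat_apply (w : ℂ) (hw : 0 < w.re) (x : ℝ) :
    complexBsplineHat w hw x = Xi (2 * Real.pi * x) ^ w := rfl

theorem complexBsplineHat_ne_zero (w : ℂ) (hw : 0 < w.re) {x : ℝ}
    (hx : x ∈ Set.Icc (-(1 / 2) : ℝ) (1 / 2)) : complexBsplineHat w hw x ≠ 0 := by
  rw [complexBsplineHat_apply, Complex.cpow_def_of_ne_zero]
  · exact Complex.exp_ne_zero _
  · refine Xi_ne_zero ?_
    rw [abs_mul, abs_of_pos Real.two_pi_pos]
    have := abs_le.2 hx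
    nlinarith [Real.pi_pos]

/-- Since |arg| ≤ π, |z^w| ≤ |z|^{Re w} e^{π|Im w|}; with |Ξ(2πx)| ≤ 1/|x| this gives decay of order
|x|^{-Re w}, summable over the integers because Re w > 1. -/
theorem isGenerator_complexBsplineHat {w : ℂ} (hw : 0 < w.re) (hw1 : 1 < w.re) :
    IsGenerator (complexBsplineHat w hw) := by
  have hO : complexBsplineHat w hw =O[cocompact ℝ] fun x : ℝ => |x| ^ (-w.re) := by
    refine Asymptotics.IsBigO.of_bound (Real.exp (Real.pi * |w.im|)) ?_
    have hev : ∀ᶠ x : ℝ in cocompact ℝ, x ≠ 0 := by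
      have := (isCompact_singleton (x := (0 : ℝ))).compl_mem_cocompact
      filter_upwards [this] with x hx using hx
    filter_upwards [hev] with x hx
    have h2 : ‖Xi (2 * Real.pi * x)‖ ≤ |x|⁻¹ := by
      refine (norm_Xi_le (mul_ne_zero Real.two_pi_pos.ne' hx)).trans ?_
      rw [abs_mul, abs_of_pos Real.two_pi_pos, div_le_iff₀ (by positivity)]
      have : |x| ≠ 0 := by positivity
      field_simp
      linarith [Real.pi_gt_three]
    rw [complexBsplineHat_apply, Real.norm_of_nonneg (by positivity), Real.rpow_neg (abs_nonneg _),
      ← Real.inv_rpow (abs_nonneg _), mul_comm (Real.exp _)]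
    refine (Complex.norm_cpow_le _ _).trans ?_
    rw [div_eq_mul_inv, ← Real.exp_neg]
    refine mul_le_mul (Real.rpow_le_rpow (norm_nonneg _) h2 hw.le) (Real.exp_le_exp.2 ?_)
      (Real.exp_pos _).le (by positivity)
    refine (neg_le_abs _).trans ?_
    rw [abs_mul]
    exact mul_le_mul_of_nonneg_right (Complex.abs_arg_le_pi _) (abs_nonneg _)
  exact fun K => summable_of_isBigO (Real.summable_abs_int_rpow hw1)
    ((isBigO_norm_restrict_cocompact _ hw hO K).comp_tendsto Int.tendsto_coe_cofinite)

/-! ### Periodization and the Hurwitz zeta function -/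

theorem ofReal_mul_cpow {r : ℝ} (hr : 0 < r) {z : ℂ} (hz : z ≠ 0) (w : ℂ) :
    ((r : ℂ) * z) ^ w = (r : ℂ) ^ w * z ^ w := by
  have hr' : (r : ℂ) ≠ 0 := by exact_mod_cast hr.ne'
  rw [Complex.cpow_def_of_ne_zero (mul_ne_zero hr' hz), Complex.cpow_def_of_ne_zero hr',
    Complex.cpow_def_of_ne_zero hz, Complex.log_ofReal_mul hr hz, ← Complex.exp_add,
    Complex.ofReal_log hr.le]
  ring_nf

/-- In the lower half-plane arg(-z) = arg z + π stays in the principal range. This is the origin of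
the factor e^{iπw}. -/
theorem neg_cpow_of_im_neg {z : ℂ} (hz : z.im < 0) (w : ℂ) :
    (-z) ^ w = Complex.exp (Complex.I * Real.pi * w) * z ^ w := by
  have h0 : z ≠ 0 := by
    rintro rfl
    simp at hz
  rw [Complex.cpow_def_of_ne_zero (neg_ne_zero.2 h0), Complex.cpow_def_of_ne_zero h0,
    ← Complex.exp_add, Complex.log, Complex.log, norm_neg,
    Complex.arg_neg_eq_arg_add_pi_of_im_neg hz]
  push_cast
  ring_nf

theorem ofReal_inv_cpow {r : ℝ} (hr : 0 < r) (w : ℂ) :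
    ((r⁻¹ : ℝ) : ℂ) ^ w = 1 / (r : ℂ) ^ w := by
  rw [Complex.ofReal_inv, Complex.inv_cpow, one_div]
  rw [Complex.arg_ofReal_of_nonneg hr.le]
  exact Real.pi_pos.ne

theorem exp_two_pi_add_int (α : ℝ) (n : ℤ) :
    Complex.exp (-(Complex.I * ((2 * Real.pi * (α + n) : ℝ) : ℂ)))
      = Complex.exp (-(Complex.I * ((2 * Real.pi * α : ℝ) : ℂ))) := by
  rw [Complex.exp_eq_exp_iff_exists_int]
  refine ⟨-n, ?_⟩
  push_cast
  ring

/-- The numerator of Ξ is 2π-periodic, so only the denominator changes. -/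
theorem Xi_add_int {α : ℝ} {n : ℤ} (h0 : α ≠ 0) (hn : α + n ≠ 0) :
    Xi (2 * Real.pi * (α + n)) = (α / (α + n) : ℝ) * Xi (2 * Real.pi * α) := by
  have hpi := Real.two_pi_pos.ne'
  rw [Xi, if_neg (mul_ne_zero hpi hn), Xi, if_neg (mul_ne_zero hpi h0), exp_two_pi_add_int]
  have h1 : (α : ℂ) ≠ 0 := by exact_mod_cast h0
  have h2 : (α + n : ℂ) ≠ 0 := by exact_mod_cast hn
  have h3 : (Real.pi : ℂ) ≠ 0 := by exact_mod_cast Real.pi_pos.ne'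
  push_cast
  field_simp

theorem Xi_im_neg {α : ℝ} (hα : α ∈ Set.Ioo (0 : ℝ) 1) : (Xi (2 * Real.pi * α)).im < 0 := by
  obtain ⟨h0, h1⟩ := hα
  have hne : 2 * Real.pi * α ≠ 0 := by positivity
  rw [(Xi_re_im hne).2]
  refine div_neg_of_neg_of_pos (sub_neg.2 (lt_of_le_of_ne (Real.cos_le_one _) fun hc => ?_))
    (by positivity)
  exact hne ((Real.cos_eq_one_iff_of_lt_of_lt (by nlinarith [Real.pi_pos])
    (by nlinarith [Real.pi_pos])).1 hc)

theorem complexBsplineHat_add_nat {w : ℂ} (hw : 0 < w.re) {α : ℝ} (hα : α ∈ Set.Ioo (0 : ℝ) 1)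
    (n : ℕ) : complexBsplineHat w hw (α + (n : ℤ))
      = (α : ℂ) ^ w * Xi (2 * Real.pi * α) ^ w * (1 / (n + α : ℂ) ^ w) := by
  have hX : Xi (2 * Real.pi * α) ≠ 0 := fun h => by simpa [h] using Xi_im_neg hα
  have h0 := hα.1
  have hn : 0 < (n : ℝ) + α := by positivity
  have hn' : α + ((n : ℤ) : ℝ) = n + α := by rw [Int.cast_natCast, add_comm]
  rw [complexBsplineHat_apply, Xi_add_int h0.ne' (by rw [hn']; exact hn.ne'), hn',
    ofReal_mul_cpow (by positivity) hX, div_eq_mul_inv, Complex.ofReal_mul,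
    ofReal_mul_cpow h0 (by exact_mod_cast (inv_pos.2 hn).ne'), ofReal_inv_cpow hn]
  push_cast
  ring

theorem complexBsplineHat_add_neg_nat {w : ℂ} (hw : 0 < w.re) {α : ℝ}
    (hα : α ∈ Set.Ioo (0 : ℝ) 1) (n : ℕ) :
    complexBsplineHat w hw (α + (-(n + 1 : ℤ) : ℤ))
      = (α : ℂ) ^ w * Xi (2 * Real.pi * α) ^ w * Complex.exp (Complex.I * Real.pi * w) *
        (1 / (n + (1 - α : ℝ) : ℂ) ^ w) := by
  have hX : Xi (2 * Real.pi * α) ≠ 0 := fun h => by simpa [h] using Xi_im_neg hα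
  have h0 := hα.1
  have hn : 0 < (n : ℝ) + (1 - α) := by
    have : (0 : ℝ) ≤ n := by positivity
    linarith [hα.2]
  have hn' : α + ((-(n + 1 : ℤ) : ℤ) : ℝ) = -((n : ℝ) + (1 - α)) := by
    push_cast
    ring
  rw [complexBsplineHat_apply, Xi_add_int h0.ne' (by rw [hn']; exact neg_ne_zero.2 hn.ne'),
    hn', div_neg, Complex.ofReal_neg, neg_mul, ← mul_neg,
    ofReal_mul_cpow (by positivity) (neg_ne_zero.2 hX), neg_cpow_of_im_neg (Xi_im_neg hα),
    div_eq_mul_inv, Complex.ofReal_mul,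
    ofReal_mul_cpow h0 (by exact_mod_cast (inv_pos.2 hn).ne'), ofReal_inv_cpow hn]
  push_cast
  ring

/-- By `Xi_add_int`, the translates with n ≥ 0 multiply Ξ by a positive factor and sum to ζ(w, α).
Those with n ≤ -1 multiply it by a negative one; as Im Ξ < 0, they contribute e^{iπw} ζ(w, 1-α). -/
theorem tsum_complexBsplineHat {w : ℂ} (hw : 0 < w.re) (hw1 : 1 < w.re) {α : ℝ}
    (hα : α ∈ Set.Ioo (0 : ℝ) 1) :
    ∑' n : ℤ, complexBsplineHat w hw (α + n)
      = (α : ℂ) ^ w * Xi (2 * Real.pi * α) ^ w *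
        (HurwitzZeta.hurwitzZeta (α : UnitAddCircle) w + Complex.exp (Complex.I * Real.pi * w) *
          HurwitzZeta.hurwitzZeta ((1 - α : ℝ) : UnitAddCircle) w) := by
  have hz1 := (HurwitzZeta.hasSum_hurwitzZeta_of_one_lt_re ⟨hα.1.le, hα.2.le⟩ hw1).mul_left
    ((α : ℂ) ^ w * Xi (2 * Real.pi * α) ^ w)
  have hz2 := (HurwitzZeta.hasSum_hurwitzZeta_of_one_lt_re (a := 1 - α)
    ⟨by linarith [hα.2], by linarith [hα.1]⟩ hw1).mul_left
      ((α : ℂ) ^ w * Xi (2 * Real.pi * α) ^ w * Complex.exp (Complex.I * Real.pi * w))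
  simp only [← complexBsplineHat_add_nat hw hα] at hz1
  simp only [← complexBsplineHat_add_neg_nat hw hα] at hz2
  have h := HasSum.of_nat_of_neg_add_one (f := fun n : ℤ => complexBsplineHat w hw (α + n)) hz1 hz2
  rw [h.tsum_eq]
  ring

/-- The zeta formula does not cover α = 0; there Ξ(2πn) = 0 for n ≠ 0 and only the central term
survives. -/
theorem tsum_complexBsplineHat_zero {w : ℂ} (hw : 0 < w.re) :
    ∑' n : ℤ, complexBsplineHat w hw (0 + n) = 1 := by
  rw [tsum_eq_single 0]
  · simp [complexBsplineHat_apply, Xi]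
  · intro n hn
    have hn' : (n : ℝ) ≠ 0 := by exact_mod_cast hn
    have hX : Xi (2 * Real.pi * (0 + n)) = 0 := by
      rw [Xi, if_neg (mul_ne_zero Real.two_pi_pos.ne' (by rwa [zero_add])), exp_two_pi_add_int]
      simp
    rw [complexBsplineHat_apply, hX, Complex.zero_cpow]
    rintro rfl
    simp at hw

theorem IsZeroFreeRegion.zak_ne_zero {R : Set ℂ} (hR : IsZeroFreeRegion R) {w : ℂ} (hwR : w ∈ R)
    (hw : 0 < w.re) (hw1 : 1 < w.re) (y : UnitAddCircle) :
    zak (complexBsplineHat w hw) 0 y ≠ 0 := by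
  obtain ⟨x, rfl⟩ := QuotientAddGroup.mk_surjective y
  have hx : (x : UnitAddCircle) = (Int.fract x : ℝ) := by
    conv_lhs => rw [← Int.fract_add_floor x]
    rw [AddCircle.coe_add, add_eq_left, AddCircle.coe_eq_zero_iff]
    exact ⟨⌊x⌋, by simp⟩
  change zak (complexBsplineHat w hw) 0 (x : UnitAddCircle) ≠ 0
  rw [hx, zak_coe (isGenerator_complexBsplineHat hw hw1)]
  simp only [character, ContinuousMap.coe_mk, Complex.ofReal_zero, mul_zero, Complex.exp_zero,
    mul_one]
  rcases (Int.fract_nonneg x).eq_or_lt with h0 | h0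
  · rw [← h0, tsum_complexBsplineHat_zero]
    exact one_ne_zero
  have hα : Int.fract x ∈ Set.Ioo (0 : ℝ) 1 := ⟨h0, Int.fract_lt_one x⟩
  set α := Int.fract x
  have hαc : (α : ℂ) ≠ 0 := by exact_mod_cast h0.ne'
  rw [tsum_complexBsplineHat hw hw1 hα]
  have hX : Xi (2 * Real.pi * α) ≠ 0 := fun h => by simpa [h] using Xi_im_neg hα
  refine mul_ne_zero (mul_ne_zero ?_ ?_) ?_
  · rw [Complex.cpow_def_of_ne_zero hαc]
    exact Complex.exp_ne_zero _
  · rw [Complex.cpow_def_of_ne_zero hX]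
    exact Complex.exp_ne_zero _
  · intro h
    -- Multiplied by e^{-iπw}, the bracket becomes ζ(w, 1-α) + e^{-iπw} ζ(w, α), which is the
    -- excluded combination at 1-α rather than α.
    refine hR.zero_free w hwR hw1 (1 - α) ⟨by linarith [hα.2], by linarith⟩ ?_
    have h4 : Complex.exp (-(Complex.I * Real.pi * w)) * Complex.exp (Complex.I * Real.pi * w)
        = 1 := by
      rw [← Complex.exp_add, neg_add_cancel, Complex.exp_zero]
    rw [sub_sub_cancel]
    linear_combination Complex.exp (-(Complex.I * Real.pi * w)) * h
      - HurwitzZeta.hurwitzZeta ((1 - α : ℝ) : UnitAddCircle) w * h4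

/-! ### Division by the periodization -/

section Dual

variable {g : C(ℝ, ℂ)} (hz : ∀ y, zak g 0 y ≠ 0)

/-- The inverse of the periodization of `g`. -/
def zakInv : C(UnitAddCircle, ℂ) :=
  ⟨fun y => (zak g 0 y)⁻¹, (map_continuous (zak g 0)).inv₀ hz⟩

/-- The quotient of `g` by its periodization. -/
def dualGenerator : C(ℝ, ℂ) :=
  ⟨fun x => zakInv hz (x : UnitAddCircle) * g x,
    ((map_continuous (zakInv hz)).comp (AddCircle.continuous_mk' 1)).mul (map_continuous g)⟩

theorem dualGenerator_apply (x : ℝ) :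
    dualGenerator hz x = zakInv hz (x : UnitAddCircle) * g x := rfl

theorem eq_zak_mul_dualGenerator (x : ℝ) :
    g x = zak g 0 (x : UnitAddCircle) * dualGenerator hz x := by
  rw [dualGenerator_apply, ← mul_assoc]
  change g x = zak g 0 (x : UnitAddCircle) * (zak g 0 (x : UnitAddCircle))⁻¹ * g x
  rw [mul_inv_cancel₀ (hz _), one_mul]

theorem isGenerator_dualGenerator (hg : IsGenerator g) : IsGenerator (dualGenerator hz) := by
  refine hg.of_norm_le ‖zakInv hz‖ fun x => ?_
  rw [dualGenerator_apply, norm_mul]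
  exact mul_le_mul_of_nonneg_right ((zakInv hz).norm_coe_le_norm _) (norm_nonneg _)

theorem dualGenerator_ne_zero {x : ℝ} (hx : g x ≠ 0) : dualGenerator hz x ≠ 0 :=
  mul_ne_zero (inv_ne_zero (hz _)) hx

theorem tsum_eq_zak_zero (hg : IsGenerator g) (x : ℝ) :
    ∑' n : ℤ, g (x + n) = zak g 0 (x : UnitAddCircle) := by
  rw [zak_coe hg]
  simp [character]

theorem tsum_dualGenerator (hg : IsGenerator g) (x : ℝ) :
    ∑' n : ℤ, dualGenerator hz (x + n) = 1 := by
  rw [tsum_eq_zak_zero (isGenerator_dualGenerator hz hg),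
    zak_eq_mul (isGenerator_dualGenerator hz hg) hg (dualGenerator_apply hz)]
  exact inv_mul_cancel₀ (hz _)

end Dual

/-! ### Idempotent decomposition of the quaternionic power -/

/-- An imaginary unit in the direction of the vector part of `q`. -/
def unitDir (q : Quaternion ℝ) : Quaternion ℂ := if ‖q.im‖ = 0 then ⟨0, 1, 0, 0⟩ else unitVec q

theorem unitDir_of_norm_eq_zero {q : Quaternion ℝ} (h : ‖q.im‖ = 0) :
    unitDir q = ⟨0, 1, 0, 0⟩ := if_pos h

theorem unitDir_of_norm_ne_zero {q : Quaternion ℝ} (h : ‖q.im‖ ≠ 0) : unitDir q = unitVec q :=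
  if_neg h

theorem mul_self_eq_neg_one {n : Quaternion ℂ} (h0 : n.re = 0)
    (h1 : n.imI ^ 2 + n.imJ ^ 2 + n.imK ^ 2 = 1) : n * n = -1 := by
  ext
  · simp only [Quaternion.re_mul, Quaternion.re_neg, Quaternion.re_one, h0]
    linear_combination -h1
  all_goals
    simp only [Quaternion.imI_mul, Quaternion.imJ_mul, Quaternion.imK_mul, Quaternion.imI_neg,
      Quaternion.imJ_neg, Quaternion.imK_neg, Quaternion.imI_one, Quaternion.imJ_one,
      Quaternion.imK_one, h0]
    ring

/-- The default unit e₁ for v = 0 keeps this identity, and with it the idempotents, available for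
every q; `unitVec` would be 0 there. -/
theorem unitDir_mul_self (q : Quaternion ℝ) : unitDir q * unitDir q = -1 := by
  by_cases h : ‖q.im‖ = 0
  · rw [unitDir_of_norm_eq_zero h]
    exact mul_self_eq_neg_one rfl (by simp)
  · have hq : q.imI ^ 2 + q.imJ ^ 2 + q.imK ^ 2 = ‖q.im‖ ^ 2 := by
      have h1 := Quaternion.normSq_eq_norm_mul_self q.im
      rw [Quaternion.normSq_def'] at h1
      simp only [Quaternion.re_im, Quaternion.imI_im, Quaternion.imJ_im, Quaternion.imK_im] at h1
      linarith
    have hdiv : (q.imI / ‖q.im‖) ^ 2 + (q.imJ / ‖q.im‖) ^ 2 + (q.imK / ‖q.im‖) ^ 2 = 1 := by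
      rw [div_pow, div_pow, div_pow, ← add_div, ← add_div, hq, div_self (pow_ne_zero 2 h)]
    rw [unitDir_of_norm_ne_zero h]
    refine mul_self_eq_neg_one rfl ?_
    simp only [unitVec]
    exact_mod_cast hdiv

/-- The idempotent on which left multiplication by `unitDir q` acts as `i`. -/
def idemPos (q : Quaternion ℝ) : Quaternion ℂ := (1 / 2 : ℂ) • (1 - Complex.I • unitDir q)

/-- The idempotent on which left multiplication by `unitDir q` acts as `-i`. -/
def idemNeg (q : Quaternion ℝ) : Quaternion ℂ := (1 / 2 : ℂ) • (1 + Complex.I • unitDir q)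

theorem isIdempotentPair (q : Quaternion ℝ) : IsIdempotentPair (idemPos q) (idemNeg q) := by
  have h : (Complex.I • unitDir q) * (Complex.I • unitDir q) = 1 := by
    rw [smul_mul_assoc, mul_smul_comm, unitDir_mul_self, smul_smul, Complex.I_mul_I, neg_smul,
      one_smul, neg_neg]
  unfold idemPos idemNeg
  generalize Complex.I • unitDir q = n at h
  constructor
  any_goals
    simp only [smul_mul_assoc, mul_smul_comm, sub_mul, mul_sub, add_mul, mul_add, one_mul, mul_one,
      h]
  all_goals module

/-- Formally z^q = z^a exp(n|v| log z), where n = `unitDir q` acts as i on `idemPos q` and as -i on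
`idemNeg q`. Positivity of Sc q makes both sides vanish at z = 0. -/
theorem qpow_eq {q : Quaternion ℝ} (hq : 0 < q.re) (z : ℂ) :
    qpow z q = z ^ ((q.re : ℂ) + Complex.I * (‖q.im‖ : ℂ)) • idemPos q
      + z ^ (conj ((q.re : ℂ) + Complex.I * (‖q.im‖ : ℂ))) • idemNeg q := by
  have hconj : conj ((q.re : ℂ) + Complex.I * (‖q.im‖ : ℂ))
      = (q.re : ℂ) - Complex.I * (‖q.im‖ : ℂ) := by
    simp [sub_eq_add_neg]
  have hdir (c : ℂ) : Complex.sin (‖q.im‖ * c) • unitVec q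
      = Complex.sin (‖q.im‖ * c) • unitDir q := by
    by_cases h : ‖q.im‖ = 0
    -- For v = 0 the sine vanishes, so the choice of unit is immaterial.
    · simp only [h, Complex.ofReal_zero, zero_mul, Complex.sin_zero, zero_smul]
    · rw [unitDir_of_norm_ne_zero h]
  rw [qpow, hdir, hconj]
  by_cases hz : z = 0
  · have h1 : (q.re : ℂ) ≠ 0 := by exact_mod_cast hq.ne'
    have h2 : (q.re : ℂ) + Complex.I * (‖q.im‖ : ℂ) ≠ 0 := fun h => by
      have := congrArg Complex.re h
      simp at this
      exact hq.ne' this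
    have h3 : (q.re : ℂ) - Complex.I * (‖q.im‖ : ℂ) ≠ 0 := fun h => by
      have := congrArg Complex.re h
      simp at this
      exact hq.ne' this
    rw [hz, Complex.zero_cpow h1, Complex.zero_cpow h2, Complex.zero_cpow h3]
    simp only [zero_smul, add_zero]
  · rw [Complex.cpow_add _ _ hz, Complex.cpow_sub _ _ hz, div_eq_mul_inv, ← Complex.cpow_neg]
    have h1 : z ^ (Complex.I * (‖q.im‖ : ℂ)) = Complex.cos (‖q.im‖ * Complex.log z)
        + Complex.sin (‖q.im‖ * Complex.log z) * Complex.I := by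
      rw [Complex.cpow_def_of_ne_zero hz, ← Complex.exp_mul_I]
      ring_nf
    have h2 : z ^ (-(Complex.I * (‖q.im‖ : ℂ))) = Complex.cos (‖q.im‖ * Complex.log z)
        - Complex.sin (‖q.im‖ * Complex.log z) * Complex.I := by
      have h3 := Complex.exp_mul_I (-(‖q.im‖ * Complex.log z))
      rw [Complex.cos_neg, Complex.sin_neg, neg_mul (Complex.sin _), ← sub_eq_add_neg] at h3
      rw [Complex.cpow_def_of_ne_zero hz, ← h3]
      ring_nf
    rw [h1, h2, idemPos, idemNeg]
    simp only [smul_add, smul_sub, smul_smul]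
    have hI := Complex.I_mul_I
    match_scalars
    · ring
    · linear_combination ((z ^ (q.re : ℂ)) * Complex.sin (‖q.im‖ * Complex.log z)) * hI

/-- The substitution ξ = 2πx absorbs the normalization 1/(2π). -/
theorem invFourier_eq_pairSynth (e₁ e₂ : Quaternion ℂ) {g₁ g₂ : C(ℝ, ℂ)} (hg₁ : IsGenerator g₁)
    (hg₂ : IsGenerator g₂) {F : ℝ → Quaternion ℂ}
    (hF : ∀ x : ℝ, F (2 * Real.pi * x) = g₁ x • e₁ + g₂ x • e₂) :
    invFourier F = pairSynth e₁ e₂ g₁ g₂ := by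
  ext1 t
  have hpi := Real.two_pi_pos
  have hint {g : C(ℝ, ℂ)} (hg : IsGenerator g) : Integrable fun x => g x * character t x :=
    (hg.mul_character t).integrable
  set K : ℝ → Quaternion ℂ :=
    fun x => (g₁ x * character t x) • e₁ + (g₂ x * character t x) • e₂ with hK
  have h1 (ξ : ℝ) : Complex.exp (Complex.I * ξ * t) • F ξ = K (ξ / (2 * Real.pi)) := by
    have hξ : 2 * Real.pi * (ξ / (2 * Real.pi)) = ξ := by field_simp
    have hc : Complex.exp (Complex.I * ξ * t) = character t (ξ / (2 * Real.pi)) := by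
      simp only [character, ContinuousMap.coe_mk]
      congr 1
      have : (Real.pi : ℂ) ≠ 0 := by exact_mod_cast Real.pi_pos.ne'
      push_cast
      field_simp
    have hFξ := hF (ξ / (2 * Real.pi))
    rw [hξ] at hFξ
    rw [hFξ, hc, smul_add, smul_smul, smul_smul, mul_comm, mul_comm _ (g₂ _)]
  have h2 : ∫ x : ℝ, K x = pairSynth e₁ e₂ g₁ g₂ t := by
    rw [hK, integral_add ((hint hg₁).smul_const e₁) ((hint hg₂).smul_const e₂),
      integral_smul_const, integral_smul_const]
    rfl
  simp only [invFourier, h1]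
  rw [Measure.integral_comp_div K, h2, abs_of_pos hpi, ← Complex.coe_smul, smul_smul]
  have h3 : (1 / (2 * Real.pi) : ℂ) * ((2 * Real.pi : ℝ) : ℂ) = 1 := by
    have : (Real.pi : ℂ) ≠ 0 := by exact_mod_cast Real.pi_pos.ne'
    push_cast
    field_simp
  rw [h3, one_smul]

/-- Multiplication is componentwise along the idempotents. `Ring.inverse` is 0 on non-units, so an
explicit two-sided inverse is exhibited. -/
theorem IsIdempotentPair.ringInverse {e₁ e₂ : Quaternion ℂ} (he : IsIdempotentPair e₁ e₂)
    {c₁ c₂ : ℂ} (h₁ : c₁ ≠ 0) (h₂ : c₂ ≠ 0) :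
    Ring.inverse (c₁ • e₁ + c₂ • e₂) = c₁⁻¹ • e₁ + c₂⁻¹ • e₂ := by
  have key {a b c d : ℂ} (h : a * c = 1) (h' : b * d = 1) :
      (a • e₁ + b • e₂) * (c • e₁ + d • e₂) = 1 := by
    simp only [add_mul, mul_add, smul_mul_assoc, mul_smul_comm, he.left_idem, he.right_idem,
      he.left_right, he.right_left, smul_zero, add_zero, zero_add, smul_smul]
    rw [mul_comm c a, mul_comm d b, h, h', one_smul, one_smul, he.add_eq_one]
  exact Ring.inverse_unit ⟨c₁ • e₁ + c₂ • e₂, c₁⁻¹ • e₁ + c₂⁻¹ • e₂,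
    key (mul_inv_cancel₀ h₁) (mul_inv_cancel₀ h₂), key (inv_mul_cancel₀ h₁) (inv_mul_cancel₀ h₂)⟩

theorem bsplineHat_eq {q : Quaternion ℝ} {w₁ w₂ : ℂ} (hq : 0 < q.re)
    (hw₁ : 0 < w₁.re) (hw₂ : 0 < w₂.re) (h₁ : w₁ = (q.re : ℂ) + Complex.I * (‖q.im‖ : ℂ))
    (h₂ : w₂ = conj w₁) (x : ℝ) :
    bsplineHat q (2 * Real.pi * x)
      = complexBsplineHat w₁ hw₁ x • idemPos q + complexBsplineHat w₂ hw₂ x • idemNeg q := by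
  rw [bsplineHat, qpow_eq hq, complexBsplineHat_apply, complexBsplineHat_apply, h₂, h₁]

theorem cardinalHat_eq {q : Quaternion ℝ} {e₁ e₂ : Quaternion ℂ} (he : IsIdempotentPair e₁ e₂)
    {g₁ g₂ : C(ℝ, ℂ)} (hg₁ : IsGenerator g₁) (hg₂ : IsGenerator g₂)
    (hz₁ : ∀ y, zak g₁ 0 y ≠ 0) (hz₂ : ∀ y, zak g₂ 0 y ≠ 0)
    (hq : ∀ x : ℝ, bsplineHat q (2 * Real.pi * x) = g₁ x • e₁ + g₂ x • e₂) (x : ℝ) :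
    cardinalHat q (2 * Real.pi * x) = dualGenerator hz₁ x • e₁ + dualGenerator hz₂ x • e₂ := by
  have hs : ∑' k : ℤ, bsplineHat q (2 * Real.pi * x + 2 * Real.pi * k)
      = zak g₁ 0 (x : UnitAddCircle) • e₁ + zak g₂ 0 (x : UnitAddCircle) • e₂ := by
    have s₁ := ((hg₁.summable_norm x).of_norm.hasSum.smul_const e₁)
    have s₂ := ((hg₂.summable_norm x).of_norm.hasSum.smul_const e₂)
    rw [tsum_eq_zak_zero hg₁] at s₁
    rw [tsum_eq_zak_zero hg₂] at s₂
    rw [← (s₁.add s₂).tsum_eq]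
    congr 1
    ext1 k
    rw [← mul_add, hq]
  rw [cardinalHat, hs, he.ringInverse (hz₁ _) (hz₂ _), hq]
  simp only [add_mul, mul_add, smul_mul_assoc, mul_smul_comm, he.left_idem, he.right_idem,
    he.left_right, he.right_left, smul_zero, add_zero, zero_add, smul_smul]
  rfl

end

end QuatSpline

theorem mainTheorem1 (R : Set ℂ) (hR : QuatSpline.IsZeroFreeRegion R)
    (q : Quaternion ℝ) (hqR : q ∈ QuatSpline.quatRegion R) (hq : 1 < q.re) :
    (∀ f ∈ QuatSpline.shiftSpace (QuatSpline.bspline q),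
      MeasureTheory.MemLp f 2 MeasureTheory.volume ∧
      (∀ N : ℕ, MeasureTheory.MemLp (QuatSpline.samplingSum q f N) 2 MeasureTheory.volume) ∧
      Filter.Tendsto
        (fun N : ℕ => MeasureTheory.eLpNorm (fun t => f t - QuatSpline.samplingSum q f N t) 2
          MeasureTheory.volume)
        Filter.atTop (nhds 0) ∧
      (∀ t : ℝ, Filter.Tendsto (fun N : ℕ => QuatSpline.samplingSum q f N t)
        Filter.atTop (nhds (f t))) ∧
      (∀ K : Set ℝ, IsCompact K →
        TendstoUniformlyOn (QuatSpline.samplingSum q f) f Filter.atTop K)) ∧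
    QuatSpline.shiftSpace (QuatSpline.bspline q)
      = QuatSpline.shiftSpace (QuatSpline.cardinalSpline q) ∧
    QuatSpline.L2NormEquivalence (QuatSpline.bspline q) ∧
    QuatSpline.L2NormEquivalence (QuatSpline.cardinalSpline q) := by
  open QuatSpline in
  obtain ⟨w₁, hw₁⟩ : ∃ w : ℂ, w = (q.re : ℂ) + Complex.I * (‖q.im‖ : ℂ) := ⟨_, rfl⟩
  obtain ⟨w₂, hw₂⟩ : ∃ w : ℂ, w = (starRingEnd ℂ) w₁ := ⟨_, rfl⟩
  have hR₁ : w₁ ∈ R := hw₁ ▸ hqR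
  have hR₂ : w₂ ∈ R := hw₂ ▸ hR.conj_mem w₁ hR₁
  have hre₁ : 1 < w₁.re := by simpa [hw₁] using hq
  have hre₂ : 1 < w₂.re := by simpa [hw₂] using hre₁
  have hp₁ : 0 < w₁.re := by linarith
  have hp₂ : 0 < w₂.re := by linarith
  have hB := bsplineHat_eq (by linarith : 0 < q.re) hp₁ hp₂ hw₁ hw₂
  have he := isIdempotentPair q
  have hg₁ := isGenerator_complexBsplineHat hp₁ hre₁
  have hg₂ := isGenerator_complexBsplineHat hp₂ hre₂
  have hz₁ := hR.zak_ne_zero hR₁ hp₁ hre₁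
  have hz₂ := hR.zak_ne_zero hR₂ hp₂ hre₂
  have hL := cardinalHat_eq he hg₁ hg₂ hz₁ hz₂ hB
  have hh₁ := isGenerator_dualGenerator hz₁ hg₁
  have hh₂ := isGenerator_dualGenerator hz₂ hg₂
  have hbs : bspline q = _ := invFourier_eq_pairSynth _ _ hg₁ hg₂ hB
  have hcs : cardinalSpline q = _ := invFourier_eq_pairSynth _ _ hh₁ hh₂ hL
  obtain ⟨_, _, rg₁⟩ := hg₁.exists_rieszBounds fun x hx => complexBsplineHat_ne_zero w₁ hp₁ hx
  obtain ⟨_, _, rg₂⟩ := hg₂.exists_rieszBounds fun x hx => complexBsplineHat_ne_zero w₂ hp₂ hx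
  obtain ⟨_, _, rh₁⟩ := hh₁.exists_rieszBounds fun x hx =>
    dualGenerator_ne_zero hz₁ (complexBsplineHat_ne_zero w₁ hp₁ hx)
  obtain ⟨_, _, rh₂⟩ := hh₂.exists_rieszBounds fun x hx =>
    dualGenerator_ne_zero hz₂ (complexBsplineHat_ne_zero w₂ hp₂ hx)
  obtain ⟨rg₁, rg₂⟩ := rg₁.exists_common rg₂
  obtain ⟨rh₁, rh₂⟩ := rh₁.exists_common rh₂
  have hspace : shiftSpace (bspline q) = shiftSpace (cardinalSpline q) := by
    rw [hbs, hcs]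
    exact Set.Subset.antisymm
      (he.shiftSpace_subset hg₁ hg₂ hh₁ hh₂ (eq_zak_mul_dualGenerator hz₁)
        (eq_zak_mul_dualGenerator hz₂))
      (he.shiftSpace_subset hh₁ hh₂ hg₁ hg₂ (dualGenerator_apply hz₁) (dualGenerator_apply hz₂))
  refine ⟨fun f hf => ?_, hspace, hbs ▸ he.l2NormEquivalence rg₁ rg₂,
    hcs ▸ he.l2NormEquivalence rh₁ rh₂⟩
  -- The expansion of f is transferred to the shifts of L_q, which interpolates on the integers,
  -- unlike B_q in general.
  rw [hspace] at hf
  obtain ⟨_, C, -, -, hC⟩ := he.exists_norm_bounds rh₁ rh₂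
  obtain ⟨D, -, hD⟩ := exists_sup_bound (e₁ := idemPos q) (e₂ := idemNeg q) hh₁ hh₂
  rw [← hcs] at hC hD
  refine sampling_of_bounds (C := C) (D := D) (fun k => ?_)
    (fun a f h => ⟨(hC a f h).1, (hC a f h).2.2⟩)
    (fun a f h t => ?_) hf fun N t => rfl
  -- Both scalar components interpolate, so L_q(k) is the unit sequence times e₊ + e₋ = 1.
  · rw [hcs, pairSynth, synth_int hh₁ (tsum_dualGenerator hz₁ hg₁),
      synth_int hh₂ (tsum_dualGenerator hz₂ hg₂), ← smul_add, he.add_eq_one]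
    split_ifs
    · rw [one_smul]
    · rw [zero_smul]
  · rw [← (h.2 t).tsum_eq]
    exact (hD a h.1 t).2
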